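/- **Setting.** Let $n\ge 1$ be an integer and let $\lambda>0$, $p$, $m$ be real numbers with $1<p$, $(n-1)p<n$ (that is, $1<p<\frac{n}{n-1}$, with no upper bound if $n=1$) and $m>p$. Let $F(\xi,\tau,x)$ and $W(\tau,x)$ be real functions of $\xi,x\in\mathbb{R}^n$ and $\tau\in\mathbb R$ such that for all $\xi,x\in\mathbb{R}^n$ and $\tau\in[-1,1]$: * (A) $\lambda^{-1}|\xi|^p\le F(\xi,\tau,x)\le\lambda|\xi|^p$; * (B) $\lambda^{-1}(1-\tau^2)^m\le W(\tau,x)\le\lambda(1-\tau^2)^m$; * (C) for each fixed $x$, $W(\cdot,x)$ is (weakly) increasing on $[-1,0]$ and (weakly) decreasing on $[0,1]$. Put $J(v,D)=\int_D\{F(\nabla v,v,x)+W(v,x)\}\,dx$. For an open set $\Omega\subseteq\mathbb{R}^n$, a function $u\in W^{1,p}_{loc}(\Omega,[-1,1])$ is a *minimizer* of $J$ in $\Omega$ if $J(u,\Omega')\le J(v,\Omega')$ for every bounded open $\Omega'\subset\subset\Omega$ and every $v\in W^{1,p}_{loc}(\Omega,[-1,1])$ with $v=u$ a.e. in $\Omega\setminus\Omega'$.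 Since $u$ is only determined up to null sets, $u(0)$ denotes $\lim_{r\to0}\operatorname{ess\,sup}_{B_r}u$, where $B_r$ is the open ball of radius $r$ about $0$; this is the usual value if $u$ is continuous at $0$. **Lemma 2.3.** There exist a constant $\sigma>0$ and a function $h:[1,\infty)\to(0,\infty)$, both depending only on $n,p,m,\lambda$, such that the following holds for all $F,W$ satisfying (A), (B), (C), every $R\ge1$ and every open $\Omega\supseteq B_R$. If $u$ is a minimizer of $J$ in $\Omega$ and $u(0)\ge1-h(R)$, then $$\big|B_R\cap\{u\ge0\}\big|\ge\sigma R^n .$$ -/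

import Mathlib

open MeasureTheory Filter Topology Set

/-- The Dirichlet energy density `F(ξ, τ, x)` is comparable to `|ξ|^p`. -/
def DirichletGrowth {n : ℕ} (p lam : ℝ)
    (F : EuclideanSpace ℝ (Fin n) → ℝ → EuclideanSpace ℝ (Fin n) → ℝ) : Prop :=
  ∀ (ξ : EuclideanSpace ℝ (Fin n)) (τ : ℝ) (x : EuclideanSpace ℝ (Fin n)), τ ∈ Icc (-1 : ℝ) 1 →
    lam⁻¹ * ‖ξ‖ ^ p ≤ F ξ τ x ∧ F ξ τ x ≤ lam * ‖ξ‖ ^ p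

/-- The potential `W(τ, x)` is comparable to `(1 - τ²)^m`. -/
def PotentialGrowth {n : ℕ} (m lam : ℝ) (W : ℝ → EuclideanSpace ℝ (Fin n) → ℝ) : Prop :=
  ∀ (τ : ℝ) (x : EuclideanSpace ℝ (Fin n)), τ ∈ Icc (-1 : ℝ) 1 →
    lam⁻¹ * (1 - τ ^ 2) ^ m ≤ W τ x ∧ W τ x ≤ lam * (1 - τ ^ 2) ^ m

/-- For each `x`, `W(·, x)` is (weakly) increasing on `[-1, 0]` and (weakly)
decreasing on `[0, 1]`. -/
def PotentialMonotone {n : ℕ} (W : ℝ → EuclideanSpace ℝ (Fin n) → ℝ) : Prop :=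
  ∀ x : EuclideanSpace ℝ (Fin n),
    MonotoneOn (fun τ => W τ x) (Icc (-1 : ℝ) 0) ∧ AntitoneOn (fun τ => W τ x) (Icc (0 : ℝ) 1)

/-- `v ∈ W^{1,p}_loc(Ω)` with weak gradient `g`: both are in `L^p` on every compact subset of `Ω`,
and `∫_Ω v ∂ᵢφ = - ∫_Ω φ gᵢ` for all test functions `φ ∈ C_c^∞(Ω)`. The weak gradient is
determined by `v` almost everywhere in `Ω`. -/
structure HasWeakGradLoc {n : ℕ} (p : ℝ) (Ω : Set (EuclideanSpace ℝ (Fin n)))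
    (v : EuclideanSpace ℝ (Fin n) → ℝ)
    (g : EuclideanSpace ℝ (Fin n) → EuclideanSpace ℝ (Fin n)) : Prop where
  memLp : ∀ K : Set (EuclideanSpace ℝ (Fin n)), IsCompact K → K ⊆ Ω →
    MemLp v (ENNReal.ofReal p) (volume.restrict K)
  memLp_grad : ∀ K : Set (EuclideanSpace ℝ (Fin n)), IsCompact K → K ⊆ Ω →
    MemLp g (ENNReal.ofReal p) (volume.restrict K)
  integral_eq : ∀ φ : EuclideanSpace ℝ (Fin n) → ℝ, ContDiff ℝ (⊤ : ℕ∞) φ → HasCompactSupport φ →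
    tsupport φ ⊆ Ω → ∀ i : Fin n,
      ∫ x in Ω, v x * fderiv ℝ φ x (EuclideanSpace.single i 1) = - ∫ x in Ω, φ x * g x i

/-- The energy `J(v, D) = ∫_D {F(∇v, v, x) + W(v, x)} dx`, where `g = ∇v`. The integrand is
nonnegative almost everywhere for the functions `v` with values in `[-1, 1]`, to which it is
applied; the value `∞` is allowed. -/
noncomputable def glEnergy {n : ℕ}
    (F : EuclideanSpace ℝ (Fin n) → ℝ → EuclideanSpace ℝ (Fin n) → ℝ)
    (W : ℝ → EuclideanSpace ℝ (Fin n) → ℝ) (v : EuclideanSpace ℝ (Fin n) → ℝ)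
    (g : EuclideanSpace ℝ (Fin n) → EuclideanSpace ℝ (Fin n))
    (D : Set (EuclideanSpace ℝ (Fin n))) : ENNReal :=
  ∫⁻ x in D, ENNReal.ofReal (F (g x) (v x) x + W (v x) x)

/-- `u` is a minimizer of the energy in `Ω`: it belongs to `W^{1,p}_loc(Ω, [-1, 1])`, and
`J(u, Ω') ≤ J(v, Ω')` for every bounded open `Ω' ⊂⊂ Ω` and every `v ∈ W^{1,p}_loc(Ω, [-1, 1])` with
`v = u` almost everywhere in `Ω \ Ω'`. -/
def IsGLMinimizer {n : ℕ} (p : ℝ)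
    (F : EuclideanSpace ℝ (Fin n) → ℝ → EuclideanSpace ℝ (Fin n) → ℝ)
    (W : ℝ → EuclideanSpace ℝ (Fin n) → ℝ) (Ω : Set (EuclideanSpace ℝ (Fin n)))
    (u : EuclideanSpace ℝ (Fin n) → ℝ) : Prop :=
  (∀ᵐ x ∂(volume.restrict Ω), u x ∈ Icc (-1 : ℝ) 1) ∧
  ∃ gu : EuclideanSpace ℝ (Fin n) → EuclideanSpace ℝ (Fin n), HasWeakGradLoc p Ω u gu ∧
    ∀ Ω' : Set (EuclideanSpace ℝ (Fin n)), IsOpen Ω' → IsCompact (closure Ω') → closure Ω' ⊆ Ω →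
    ∀ (v : EuclideanSpace ℝ (Fin n) → ℝ)
      (gv : EuclideanSpace ℝ (Fin n) → EuclideanSpace ℝ (Fin n)),
      HasWeakGradLoc p Ω v gv →
      (∀ᵐ x ∂(volume.restrict Ω), v x ∈ Icc (-1 : ℝ) 1) →
      (∀ᵐ x ∂(volume.restrict (Ω \ Ω')), v x = u x) →
      glEnergy F W u gu Ω' ≤ glEnergy F W v gv Ω'

/-- The pointwise value of a class of functions modulo null sets: the essential upper limit
`lim_{r → 0} ess sup_{B_r(x)} u`. It does not change when `u` is modified on a null set, it is
`u x` if `u` is continuous at `x`, and it is at least the limit of the averages of `u` over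
`B_r(x)` wherever that limit exists and `u` is essentially bounded near `x`. -/
noncomputable def essValue {n : ℕ} (u : EuclideanSpace ℝ (Fin n) → ℝ)
    (x : EuclideanSpace ℝ (Fin n)) : ℝ :=
  limsup u (𝓝 x ⊓ ae volume)

theorem essValue_eq_of_continuousAt {n : ℕ} {u : EuclideanSpace ℝ (Fin n) → ℝ}
    {x : EuclideanSpace ℝ (Fin n)} (hu : ContinuousAt u x) : essValue u x = u x := by
  have hne : (𝓝 x ⊓ ae (volume : Measure (EuclideanSpace ℝ (Fin n)))).NeBot := by
    rw [Filter.inf_neBot_iff]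
    intro s hs t ht
    by_contra hst
    rw [Set.not_nonempty_iff_eq_empty] at hst
    have hsub : s ⊆ tᶜ := fun y hy hyt => by
      have : y ∈ s ∩ t := ⟨hy, hyt⟩
      rw [hst] at this
      exact this
    have h0 : volume s = 0 := measure_mono_null hsub (mem_ae_iff.1 ht)
    exact (Measure.measure_pos_of_mem_nhds volume hs).ne' h0
  exact (Tendsto.mono_left hu inf_le_left).limsup_eq

theorem essValue_congr_ae {n : ℕ} {u v : EuclideanSpace ℝ (Fin n) → ℝ}
    (huv : u =ᵐ[volume] v) (x : EuclideanSpace ℝ (Fin n)) : essValue u x = essValue v x :=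
  limsup_congr (huv.filter_mono inf_le_right)

/-!
Since `p ≤ m`, comparing a minimizer `u` with `min u (1 - ψ)`, for a barrier `ψ ≤ k ≤ 1`, bounds the
`p`-energy of `w = 1 - u` on `{w < ψ}` by a multiple of `k ^ p` times the measure of `{w < ψ}`. The
estimate is invariant under scaling of the level `k`, so `w` behaves like a supersolution. By
De Giorgi's iteration, `w ≥ k / 2` on the half ball as soon as `{w < k}` has small measure in the
ball. By the isoperimetric inequality on balls, each shell `{k / 2 ≤ w < k}` takes up a definite
measure as long as both `{w < k / 2}` and `{w ≥ 1}` do; the dyadic shells are disjoint, so `{w < k}`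
does become small. Hence if `u ≤ 0` on half of a ball, then `u ≤ 1 - κ` on a smaller ball, with
`κ > 0` depending only on the data.
-/

section Mollification

open scoped Convolution ContDiff ENNReal
open ContinuousLinearMap (lsmul)

theorem mul_indicator_of_support_subset {X : Type*} {s : Set X} {a : X → ℝ}
    (ha : Function.support a ⊆ s) (b : X → ℝ) (x : X) :
    a x * s.indicator b x = a x * b x := by
  by_cases hx : x ∈ s
  · rw [indicator_of_mem hx]
  · rw [Function.notMem_support.1 fun h => hx (ha h), zero_mul, zero_mul]

theorem fderiv_comp_const_sub {E : Type*} [NormedAddCommGroup E] [NormedSpace ℝ E] {φ : E → ℝ}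
    (hφ : Differentiable ℝ φ) (x t e : E) :
    fderiv ℝ (fun t => φ (x - t)) t e = -fderiv ℝ φ (x - t) e := by
  have h : HasFDerivAt (fun t => φ (x - t))
      ((fderiv ℝ φ (x - t)).comp (-ContinuousLinearMap.id ℝ E)) t :=
    (hφ (x - t)).hasFDerivAt.comp t ((hasFDerivAt_id t).const_sub x)
  simp [h.fderiv]

variable {E : Type*} [NormedAddCommGroup E] [NormedSpace ℝ E] [MeasurableSpace E] [BorelSpace E]
  {μ : Measure E}

/-- `v` has the weak derivative `d` in the direction `e` in `Ω`, tested against smooth functions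
with compact support in `Ω`. -/
structure HasWeakDirDeriv (μ : Measure E) (Ω : Set E) (e : E) (v d : E → ℝ) : Prop where
  locallyIntegrableOn : LocallyIntegrableOn v Ω μ
  locallyIntegrableOn_deriv : LocallyIntegrableOn d Ω μ
  integral_eq : ∀ φ : E → ℝ, ContDiff ℝ ∞ φ → HasCompactSupport φ → tsupport φ ⊆ Ω →
    ∫ x, v x * fderiv ℝ φ x e ∂μ = -∫ x, φ x * d x ∂μ

variable [FiniteDimensional ℝ E] [μ.IsAddHaarMeasure]

theorem tendsto_lintegral_enorm_translate_sub {f : E → ℝ} (hf : Integrable f μ) :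
    Tendsto (fun h => ∫⁻ x, ‖f (x - h) - f x‖ₑ ∂μ) (𝓝 0) (𝓝 0) := by
  have : Fact ((1 : ℝ≥0∞) ≠ ⊤) := ⟨ENNReal.one_ne_top⟩
  have hf1 : MemLp f 1 μ := memLp_one_iff_integrable.2 hf
  have hcont : Continuous fun h : E => DomAddAct.mk (-h) +ᵥ hf1.toLp f :=
    (DomAddAct.continuous_mk.comp continuous_neg).vadd continuous_const
  have hedist (h : E) : edist (DomAddAct.mk (-h) +ᵥ hf1.toLp f) (hf1.toLp f)
      = ∫⁻ x, ‖f (x - h) - f x‖ₑ ∂μ := by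
    rw [DomAddAct.mk_vadd_toLp, Lp.edist_toLp_toLp, eLpNorm_one_eq_lintegral_enorm]
    simp [sub_eq_neg_add]
  have hlim := (hcont.edist (continuous_const (y := hf1.toLp f))).tendsto 0
  simp_rw [hedist] at hlim
  simpa using hlim

theorem lintegral_enorm_normed (φ : ContDiffBump (0 : E)) : ∫⁻ t, ‖φ.normed μ t‖ₑ ∂μ = 1 := by
  simp_rw [Real.enorm_of_nonneg (φ.nonneg_normed _)]
  rw [← ofReal_integral_eq_lintegral_ofReal φ.integrable_normed
    (Eventually.of_forall φ.nonneg_normed), φ.integral_normed, ENNReal.ofReal_one]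

theorem ae_normed_convolution_sub_eq (φ : ContDiffBump (0 : E)) {f : E → ℝ}
    (hf : Integrable f μ) : ∀ᵐ x ∂μ, (φ.normed μ ⋆[lsmul ℝ ℝ, μ] f) x - f x
      = ∫ t, φ.normed μ t * (f (x - t) - f x) ∂μ := by
  have hex : ∀ᵐ x ∂μ, ConvolutionExistsAt (φ.normed μ) f x (lsmul ℝ ℝ) μ :=
    φ.integrable_normed.ae_convolution_exists _ hf
  filter_upwards [hex] with x hx
  have hconst : f x = ∫ t, φ.normed μ t * f x ∂μ := by
    rw [integral_mul_const, φ.integral_normed, one_mul]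
  rw [hconst, convolution_def, ← integral_sub hx.integrable (φ.integrable_normed.mul_const _),
    ← hconst]
  simp only [ContinuousLinearMap.lsmul_apply, smul_eq_mul, mul_sub]

theorem lintegral_enorm_normed_convolution_sub_le (φ : ContDiffBump (0 : E)) {f : E → ℝ}
    (hf : Integrable f μ) {ε : ℝ≥0∞}
    (hε : ∀ h ∈ Metric.ball (0 : E) φ.rOut, ∫⁻ x, ‖f (x - h) - f x‖ₑ ∂μ ≤ ε) :
    ∫⁻ x, ‖(φ.normed μ ⋆[lsmul ℝ ℝ, μ] f) x - f x‖ₑ ∂μ ≤ ε := by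
  have hmeas : AEMeasurable (Function.uncurry fun x t : E =>
      ‖φ.normed μ t * (f (x - t) - f x)‖ₑ) (μ.prod μ) := by
    have hshift : AEStronglyMeasurable (fun q : E × E => φ.normed μ q.2 * f (q.1 - q.2))
        (μ.prod μ) :=
      φ.integrable_normed.aestronglyMeasurable.convolution_integrand (lsmul ℝ ℝ)
        hf.aestronglyMeasurable
    have hfix : AEStronglyMeasurable (fun q : E × E => φ.normed μ q.2 * f q.1) (μ.prod μ) :=
      φ.integrable_normed.aestronglyMeasurable.comp_snd.mul hf.aestronglyMeasurable.comp_fst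
    refine ((hshift.sub hfix).congr (Eventually.of_forall fun q => ?_)).enorm
    simp [mul_sub]
  calc ∫⁻ x, ‖(φ.normed μ ⋆[lsmul ℝ ℝ, μ] f) x - f x‖ₑ ∂μ
      ≤ ∫⁻ x, ∫⁻ t, ‖φ.normed μ t * (f (x - t) - f x)‖ₑ ∂μ ∂μ := by
        refine lintegral_mono_ae ?_
        filter_upwards [ae_normed_convolution_sub_eq φ hf] with x hx
        exact hx ▸ enorm_integral_le_lintegral_enorm _
    _ = ∫⁻ t, ‖φ.normed μ t‖ₑ * ∫⁻ x, ‖f (x - t) - f x‖ₑ ∂μ ∂μ := by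
        rw [lintegral_lintegral_swap hmeas]
        simp_rw [enorm_mul, lintegral_const_mul' _ _ enorm_ne_top]
    _ ≤ ∫⁻ t, ‖φ.normed μ t‖ₑ * ε ∂μ := by
        refine lintegral_mono fun t => ?_
        by_cases ht : t ∈ Metric.ball (0 : E) φ.rOut
        · gcongr
          exact hε t ht
        · rw [← φ.support_normed_eq (μ := μ), Function.notMem_support] at ht
          simp [ht]
    _ = ε := by
        rw [lintegral_mul_const _ φ.continuous_normed.measurable.enorm, lintegral_enorm_normed,
          one_mul]

theorem tendsto_lintegral_enorm_normed_convolution_sub {φ : ℕ → ContDiffBump (0 : E)}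
    (hφ : Tendsto (fun j => (φ j).rOut) atTop (𝓝 0)) {f : E → ℝ} (hf : Integrable f μ) :
    Tendsto (fun j => ∫⁻ x, ‖((φ j).normed μ ⋆[lsmul ℝ ℝ, μ] f) x - f x‖ₑ ∂μ) atTop (𝓝 0) := by
  rw [ENNReal.tendsto_nhds_zero]
  intro ε hε
  obtain ⟨δ, hδ, hball⟩ := Metric.eventually_nhds_iff_ball.1
    (ENNReal.tendsto_nhds_zero.1 (tendsto_lintegral_enorm_translate_sub hf) ε hε)
  filter_upwards [hφ.eventually (gt_mem_nhds hδ)] with j hj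
  exact lintegral_enorm_normed_convolution_sub_le (φ j) hf fun h hh =>
    hball h (Metric.ball_subset_ball hj.le hh)

theorem HasWeakDirDeriv.fderiv_normed_convolution_indicator {Ω : Set E} {e : E} {v d : E → ℝ}
    (hv : HasWeakDirDeriv μ Ω e v d) {K : Set E} (hK : IsCompact K) (hKΩ : K ⊆ Ω)
    (φ : ContDiffBump (0 : E)) {x : E} (hx : Metric.closedBall x φ.rOut ⊆ K) :
    fderiv ℝ (φ.normed μ ⋆[lsmul ℝ ℝ, μ] K.indicator v) x e
      = (φ.normed μ ⋆[lsmul ℝ ℝ, μ] K.indicator d) x := by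
  set ρ := φ.normed μ with hρ
  have hρs : ContDiff ℝ ∞ ρ := φ.contDiff_normed
  have hρc : HasCompactSupport ρ := φ.hasCompactSupport_normed
  have hsupp : Function.support (fun t => ρ (x - t)) ⊆ Metric.closedBall x φ.rOut := by
    intro t ht
    have : x - t ∈ Function.support ρ := ht
    rw [hρ, φ.support_normed_eq, mem_ball_zero_iff] at this
    rw [Metric.mem_closedBall, dist_comm, dist_eq_norm]
    exact this.le
  have htsupp : tsupport (fun t => ρ (x - t)) ⊆ Metric.closedBall x φ.rOut :=
    closure_minimal hsupp Metric.isClosed_closedBall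
  have hweak := hv.integral_eq (fun t => ρ (x - t)) (hρs.comp (contDiff_const.sub contDiff_id))
    (.of_support_subset_isCompact (isCompact_closedBall x _) hsupp) (htsupp.trans (hx.trans hKΩ))
  have hsupp' : Function.support (fun t => fderiv ℝ ρ (x - t) e) ⊆ K := by
    refine fun t ht => hx (htsupp (tsupport_fderiv_apply_subset ℝ e (subset_tsupport _ ?_)))
    simpa [fderiv_comp_const_sub (hρs.differentiable (by simp))] using ht
  have hvi : LocallyIntegrable (K.indicator v) μ :=
    ((integrable_indicator_iff hK.measurableSet).2
      (hv.locallyIntegrableOn.integrableOn_compact_subset hKΩ hK)).locallyIntegrable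
  rw [(hρc.hasFDerivAt_convolution_left _ (hρs.of_le (by simp)) hvi x).fderiv,
    convolution_eq_swap, convolution_eq_swap, ContinuousLinearMap.integral_apply
      ((hρc.fderiv ℝ).convolutionExists_left _ (hρs.continuous_fderiv (by simp)) hvi
        x).integrable_swap]
  simp only [ContinuousLinearMap.precompL_apply, ContinuousLinearMap.lsmul_apply, smul_eq_mul,
    mul_indicator_of_support_subset hsupp', mul_indicator_of_support_subset (hsupp.trans hx)]
  simp only [fderiv_comp_const_sub (hρs.differentiable (by simp)), mul_neg, integral_neg,
    neg_inj] at hweak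
  simpa only [mul_comm (v _)] using hweak

theorem exists_contDiffBump_seq (E : Type*) [NormedAddCommGroup E] :
    ∃ φ : ℕ → ContDiffBump (0 : E), Tendsto (fun j => (φ j).rOut) atTop (𝓝 0) ∧
      ∀ j, (φ j).rOut ≤ 2 * (φ j).rIn :=
  ⟨fun j => ⟨1 / ((j : ℝ) + 1) / 2, 1 / ((j : ℝ) + 1), by positivity,
    half_lt_self (by positivity)⟩, tendsto_one_div_add_atTop_nhds_zero_nat,
    fun j => (mul_div_cancel₀ _ two_ne_zero).ge⟩

theorem HasWeakDirDeriv.exists_smooth_approx {Ω : Set E} {e : E} {v d : E → ℝ}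
    (hv : HasWeakDirDeriv μ Ω e v d) (hΩ : IsOpen Ω) {K : Set E} (hK : IsCompact K)
    (hKΩ : K ⊆ Ω) :
    ∃ s : ℕ → E → ℝ, (∀ j, ContDiff ℝ ∞ (s j)) ∧
      (∀ᵐ x ∂(μ.restrict K), Tendsto (fun j => s j x) atTop (𝓝 (v x))) ∧
      Tendsto (fun j => ∫⁻ x in K, ‖s j x - v x‖ₑ ∂μ) atTop (𝓝 0) ∧
      Tendsto (fun j => ∫⁻ x in K, ‖fderiv ℝ (s j) x e - d x‖ₑ ∂μ) atTop (𝓝 0) := by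
  obtain ⟨δ, hδ, hδΩ⟩ := hK.exists_cthickening_subset_open hΩ hKΩ
  obtain ⟨φ, hφ, hφ2⟩ := exists_contDiffBump_seq E
  set K' := Metric.cthickening δ K
  have hK' : IsCompact K' := hK.cthickening
  have hKK' : K ⊆ K' := Metric.self_subset_cthickening K
  have hvi : Integrable (K'.indicator v) μ := (integrable_indicator_iff hK'.measurableSet).2
    (hv.locallyIntegrableOn.integrableOn_compact_subset hδΩ hK')
  have hdi : Integrable (K'.indicator d) μ := (integrable_indicator_iff hK'.measurableSet).2
    (hv.locallyIntegrableOn_deriv.integrableOn_compact_subset hδΩ hK')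
  refine ⟨fun j => (φ j).normed μ ⋆[lsmul ℝ ℝ, μ] K'.indicator v, fun j => ?_, ?_, ?_, ?_⟩
  · exact (φ j).hasCompactSupport_normed.contDiff_convolution_left _
      (φ j).contDiff_normed hvi.locallyIntegrable
  · filter_upwards [ae_restrict_of_ae
      (ContDiffBump.ae_convolution_tendsto_right_of_locallyIntegrable (K := 2) hφ
        (Eventually.of_forall hφ2) hvi.locallyIntegrable),
      ae_restrict_mem hK.measurableSet] with x hx hxK
    rwa [indicator_of_mem (hKK' hxK)] at hx
  · refine tendsto_of_tendsto_of_tendsto_of_le_of_le tendsto_const_nhds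
      (tendsto_lintegral_enorm_normed_convolution_sub hφ hvi) (fun _ => zero_le) fun j => ?_
    refine le_trans (setLIntegral_congr_fun hK.measurableSet fun x hx => ?_).le
      (setLIntegral_le_lintegral K _)
    simp only [indicator_of_mem (hKK' hx)]
  · refine tendsto_of_tendsto_of_tendsto_of_le_of_le' tendsto_const_nhds
      (tendsto_lintegral_enorm_normed_convolution_sub hφ hdi)
      (Eventually.of_forall fun _ => zero_le) ?_
    filter_upwards [hφ.eventually (gt_mem_nhds hδ)] with j hj
    refine le_trans (setLIntegral_congr_fun hK.measurableSet fun x hx => ?_).le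
      (setLIntegral_le_lintegral K _)
    simp only [indicator_of_mem (hKK' hx), hv.fderiv_normed_convolution_indicator hK' hδΩ (φ j)
      ((Metric.closedBall_subset_closedBall hj.le).trans
        (Metric.closedBall_subset_cthickening hx δ))]

end Mollification

section WeakDerivative

open scoped ContDiff ENNReal

theorem tendsto_smoothTransition_natCast_mul (t : ℝ) :
    Tendsto (fun j : ℕ => Real.smoothTransition (j * t)) atTop
      (𝓝 ((Ioi (0 : ℝ)).indicator 1 t)) := by
  by_cases ht : 0 < t
  · rw [indicator_of_mem (mem_Ioi.2 ht)]
    refine tendsto_const_nhds.congr' ?_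
    filter_upwards [(tendsto_natCast_atTop_atTop.atTop_mul_const ht).eventually_ge_atTop 1]
      with j hj
    exact (Real.smoothTransition.one_of_one_le hj).symm
  · rw [indicator_of_notMem (by simpa using ht)]
    exact tendsto_const_nhds.congr fun j => (Real.smoothTransition.zero_of_nonpos
      (mul_nonpos_of_nonneg_of_nonpos j.cast_nonneg (not_lt.1 ht))).symm

theorem abs_smoothTransition_le_one (t : ℝ) : |Real.smoothTransition t| ≤ 1 :=
  (abs_of_nonneg (Real.smoothTransition.nonneg t)).trans_le (Real.smoothTransition.le_one t)

theorem hasDerivAt_integral_smoothTransition_mul (a t : ℝ) :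
    HasDerivAt (fun t => ∫ s in (0 : ℝ)..t, Real.smoothTransition (a * s))
      (Real.smoothTransition (a * t)) t :=
  ((Real.smoothTransition.continuous.comp
    (continuous_const_mul a)).integral_hasStrictDerivAt 0 t).hasDerivAt

theorem deriv_integral_smoothTransition_mul (a : ℝ) :
    deriv (fun t => ∫ s in (0 : ℝ)..t, Real.smoothTransition (a * s))
      = fun t => Real.smoothTransition (a * t) :=
  funext fun t => (hasDerivAt_integral_smoothTransition_mul a t).deriv

theorem contDiff_integral_smoothTransition_mul (a : ℝ) :
    ContDiff ℝ 1 fun t => ∫ s in (0 : ℝ)..t, Real.smoothTransition (a * s) := by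
  rw [contDiff_one_iff_deriv, deriv_integral_smoothTransition_mul]
  exact ⟨fun t => (hasDerivAt_integral_smoothTransition_mul a t).differentiableAt,
    Real.smoothTransition.continuous.comp (continuous_const_mul a)⟩

theorem lipschitzWith_integral_smoothTransition_mul (a : ℝ) :
    LipschitzWith 1 fun t => ∫ s in (0 : ℝ)..t, Real.smoothTransition (a * s) := by
  refine lipschitzWith_of_nnnorm_deriv_le
    ((contDiff_integral_smoothTransition_mul a).differentiable one_ne_zero) fun t => ?_
  rw [deriv_integral_smoothTransition_mul, ← NNReal.coe_le_coe]
  exact abs_smoothTransition_le_one _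

theorem tendsto_integral_smoothTransition_natCast_mul (t : ℝ) :
    Tendsto (fun j : ℕ => ∫ s in (0 : ℝ)..t, Real.smoothTransition (j * s)) atTop
      (𝓝 (max t 0)) := by
  have hlim : Tendsto (fun j : ℕ => ∫ s in (0 : ℝ)..t, Real.smoothTransition (j * s)) atTop
      (𝓝 (∫ s in (0 : ℝ)..t, (Ioi (0 : ℝ)).indicator 1 s)) :=
    intervalIntegral.tendsto_integral_filter_of_dominated_convergence (fun _ => 1)
      (Eventually.of_forall fun j =>
        (Real.smoothTransition.continuous.comp (continuous_const_mul _)).aestronglyMeasurable)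
      (Eventually.of_forall fun j => Eventually.of_forall fun s _ =>
        abs_smoothTransition_le_one _)
      (by simp) (Eventually.of_forall fun s _ => tendsto_smoothTransition_natCast_mul s)
  convert hlim using 2
  rcases le_total 0 t with ht | ht
  · rw [max_eq_left ht, intervalIntegral.integral_of_le ht, setIntegral_congr_fun
      measurableSet_Ioc fun s hs => indicator_of_mem (mem_Ioi.2 hs.1) 1]
    simp [ht]
  · rw [max_eq_right ht, intervalIntegral.integral_of_ge ht, setIntegral_congr_fun
      measurableSet_Ioc fun s hs => indicator_of_notMem (by simpa using hs.2) 1]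
    simp

theorem tendsto_lintegral_enorm_mul_sub_mul {X : Type*} [MeasurableSpace X] {ν : Measure X}
    {a b : ℕ → X → ℝ} {a' b' : X → ℝ} {C : ℝ} (ham : ∀ j, AEStronglyMeasurable (a j) ν)
    (haC : ∀ j x, |a j x| ≤ C)
    (ha : ∀ᵐ x ∂ν, Tendsto (fun j => a j x) atTop (𝓝 (a' x)))
    (hbm : ∀ j, AEStronglyMeasurable (b j) ν) (hb' : Integrable b' ν)
    (hb : Tendsto (fun j => ∫⁻ x, ‖b j x - b' x‖ₑ ∂ν) atTop (𝓝 0)) :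
    Tendsto (fun j => ∫⁻ x, ‖a j x * b j x - a' x * b' x‖ₑ ∂ν) atTop (𝓝 0) := by
  have hvary : Tendsto (fun j => ENNReal.ofReal C * ∫⁻ x, ‖b j x - b' x‖ₑ ∂ν) atTop (𝓝 0) := by
    simpa using ENNReal.Tendsto.const_mul hb (Or.inr ENNReal.ofReal_ne_top)
  have hfix : Tendsto (fun j => ∫⁻ x, ENNReal.ofReal ‖a j x * b' x - a' x * b' x‖ ∂ν)
      atTop (𝓝 0) := by
    refine tendsto_lintegral_norm_of_dominated_convergence (bound := fun x => C * ‖b' x‖)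
      (fun j => (ham j).mul hb'.aestronglyMeasurable) (hb'.norm.const_mul C).2
      (fun j => Eventually.of_forall fun x => ?_) ?_
    · rw [norm_mul]
      gcongr
      exact haC j x
    · filter_upwards [ha] with x hx using hx.mul_const _
  refine tendsto_of_tendsto_of_tendsto_of_le_of_le tendsto_const_nhds
    (by simpa using hvary.add hfix) (fun _ => zero_le) fun j => ?_
  rw [← lintegral_const_mul' _ _ ENNReal.ofReal_ne_top,
    ← lintegral_add_left' (show AEMeasurable (fun x => _ * ‖b j x - b' x‖ₑ) ν from
      ((hbm j).sub hb'.aestronglyMeasurable).enorm.const_mul _)]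
  refine lintegral_mono fun x => ?_
  have hsplit : a j x * b j x - a' x * b' x
      = a j x * (b j x - b' x) + (a j x * b' x - a' x * b' x) := by ring
  rw [hsplit]
  refine (enorm_add_le _ _).trans (add_le_add ?_ (ofReal_norm _).ge)
  rw [enorm_mul]
  gcongr
  rw [← ofReal_norm]
  exact ENNReal.ofReal_le_ofReal (haC j x)

section Pairing

variable {X : Type*} [TopologicalSpace X] [T2Space X] [MeasurableSpace X]
  [OpensMeasurableSpace X] {μ : Measure X} {v : X → ℝ}

theorem integrable_mul_of_tsupport_subset {Ω : Set X} {φ : X → ℝ}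
    (hv : LocallyIntegrableOn v Ω μ) (hφ : Continuous φ) (hφc : HasCompactSupport φ)
    (hφΩ : tsupport φ ⊆ Ω) : Integrable (fun x => v x * φ x) μ := by
  refine (integrableOn_iff_integrable_of_support_subset ?_).1
    ((hv.integrableOn_compact_subset hφΩ hφc).mul_continuousOn hφ.continuousOn hφc)
  exact (Function.support_mul_subset_right _ _).trans (subset_tsupport φ)

theorem tendsto_integral_mul_of_tendsto_lintegral {K : Set X} {a : ℕ → X → ℝ} {χ : X → ℝ}
    (hχ : Continuous χ) (hχc : HasCompactSupport χ) (hχK : tsupport χ ⊆ K) (hK : MeasurableSet K)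
    (ha : ∀ j, LocallyIntegrableOn (a j) K μ) (hv : LocallyIntegrableOn v K μ)
    (hav : Tendsto (fun j => ∫⁻ x in K, ‖a j x - v x‖ₑ ∂μ) atTop (𝓝 0)) :
    Tendsto (fun j => ∫ x, a j x * χ x ∂μ) atTop (𝓝 (∫ x, v x * χ x ∂μ)) := by
  obtain ⟨C, hC⟩ := hχ.bounded_above_of_compact_support hχc
  have hlim : Tendsto (fun j => ENNReal.ofReal C * ∫⁻ x in K, ‖a j x - v x‖ₑ ∂μ) atTop (𝓝 0) := by
    simpa using ENNReal.Tendsto.const_mul hav (Or.inr ENNReal.ofReal_ne_top)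
  refine tendsto_integral_of_L1 _
    (integrable_mul_of_tsupport_subset hv hχ hχc hχK).aestronglyMeasurable
    (Eventually.of_forall fun j => integrable_mul_of_tsupport_subset (ha j) hχ hχc hχK)
    (tendsto_of_tendsto_of_tendsto_of_le_of_le tendsto_const_nhds hlim (fun _ => zero_le)
      fun j => ?_)
  rw [← lintegral_const_mul' _ _ ENNReal.ofReal_ne_top, ← lintegral_indicator hK]
  refine lintegral_mono fun x => ?_
  by_cases hx : x ∈ K
  · rw [indicator_of_mem hx, ← sub_mul, enorm_mul, mul_comm]
    gcongr
    rw [← ofReal_norm]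
    exact ENNReal.ofReal_le_ofReal (hC x)
  · simp [image_eq_zero_of_notMem_tsupport fun h => hx (hχK h)]

end Pairing

variable {E : Type*} [NormedAddCommGroup E] [NormedSpace ℝ E]

theorem continuous_fderiv_apply_const {φ : E → ℝ} (hφ : ContDiff ℝ 1 φ) (e : E) :
    Continuous fun x => fderiv ℝ φ x e :=
  (hφ.continuous_fderiv one_ne_zero).clm_apply continuous_const

variable [MeasurableSpace E] {μ : Measure E} {Ω : Set E} {e : E} {v d v' d' : E → ℝ}

namespace HasWeakDirDeriv

theorem integrableOn (h : HasWeakDirDeriv μ Ω e v d) {K : Set E} (hK : IsCompact K)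
    (hKΩ : K ⊆ Ω) : IntegrableOn v K μ :=
  h.locallyIntegrableOn.integrableOn_compact_subset hKΩ hK

theorem integrableOn_deriv (h : HasWeakDirDeriv μ Ω e v d) {K : Set E} (hK : IsCompact K)
    (hKΩ : K ⊆ Ω) : IntegrableOn d K μ :=
  h.locallyIntegrableOn_deriv.integrableOn_compact_subset hKΩ hK

theorem neg (h : HasWeakDirDeriv μ Ω e v d) :
    HasWeakDirDeriv μ Ω e (fun x => -v x) (fun x => -d x) where
  locallyIntegrableOn := h.locallyIntegrableOn.neg
  locallyIntegrableOn_deriv := h.locallyIntegrableOn_deriv.neg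
  integral_eq φ hφ hφc hφΩ := by
    simp only [neg_mul, mul_neg, integral_neg, h.integral_eq φ hφ hφc hφΩ]

end HasWeakDirDeriv

variable [BorelSpace E]

theorem integrable_mul_fderiv_of_tsupport_subset {φ : E → ℝ}
    (hv : LocallyIntegrableOn v Ω μ) (hφ : ContDiff ℝ ∞ φ) (hφc : HasCompactSupport φ)
    (hφΩ : tsupport φ ⊆ Ω) (e : E) : Integrable (fun x => v x * fderiv ℝ φ x e) μ :=
  integrable_mul_of_tsupport_subset hv (continuous_fderiv_apply_const (hφ.of_le (by simp)) e)
    (hφc.fderiv_apply ℝ e) ((tsupport_fderiv_apply_subset ℝ e).trans hφΩ)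

namespace HasWeakDirDeriv

theorem add (h : HasWeakDirDeriv μ Ω e v d) (h' : HasWeakDirDeriv μ Ω e v' d') :
    HasWeakDirDeriv μ Ω e (fun x => v x + v' x) (fun x => d x + d' x) where
  locallyIntegrableOn := h.locallyIntegrableOn.add h'.locallyIntegrableOn
  locallyIntegrableOn_deriv := h.locallyIntegrableOn_deriv.add h'.locallyIntegrableOn_deriv
  integral_eq φ hφ hφc hφΩ := by
    have hd := integrable_mul_of_tsupport_subset h.locallyIntegrableOn_deriv hφ.continuous hφc hφΩ
    have hd' := integrable_mul_of_tsupport_subset h'.locallyIntegrableOn_deriv hφ.continuous hφc hφΩ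
    simp only [add_mul, mul_comm (φ _)]
    rw [integral_add
      (integrable_mul_fderiv_of_tsupport_subset h.locallyIntegrableOn hφ hφc hφΩ e)
      (integrable_mul_fderiv_of_tsupport_subset h'.locallyIntegrableOn hφ hφc hφΩ e),
      integral_add hd hd', h.integral_eq φ hφ hφc hφΩ, h'.integral_eq φ hφ hφc hφΩ, neg_add]
    simp only [mul_comm (φ _)]

theorem sub (h : HasWeakDirDeriv μ Ω e v d) (h' : HasWeakDirDeriv μ Ω e v' d') :
    HasWeakDirDeriv μ Ω e (fun x => v x - v' x) (fun x => d x - d' x) := by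
  simpa only [sub_eq_add_neg] using h.add h'.neg

theorem of_tendsto
    (hv : LocallyIntegrableOn v Ω μ) (hd : LocallyIntegrableOn d Ω μ)
    (happrox : ∀ K, IsCompact K → K ⊆ Ω → ∃ s t : ℕ → E → ℝ,
      (∀ j, HasWeakDirDeriv μ Ω e (s j) (t j)) ∧
      Tendsto (fun j => ∫⁻ x in K, ‖s j x - v x‖ₑ ∂μ) atTop (𝓝 0) ∧
      Tendsto (fun j => ∫⁻ x in K, ‖t j x - d x‖ₑ ∂μ) atTop (𝓝 0)) :
    HasWeakDirDeriv μ Ω e v d := by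
  refine ⟨hv, hd, fun φ hφ hφc hφΩ => ?_⟩
  obtain ⟨s, t, hst, hs, ht⟩ := happrox (tsupport φ) hφc hφΩ
  have hleft := tendsto_integral_mul_of_tendsto_lintegral
    (continuous_fderiv_apply_const (hφ.of_le (by simp)) e) (hφc.fderiv_apply ℝ e)
    (tsupport_fderiv_apply_subset ℝ e) (isClosed_tsupport φ).measurableSet
    (fun j => (hst j).locallyIntegrableOn.mono_set hφΩ) (hv.mono_set hφΩ) hs
  have hright := tendsto_integral_mul_of_tendsto_lintegral hφ.continuous hφc subset_rfl
    (isClosed_tsupport φ).measurableSet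
    (fun j => (hst j).locallyIntegrableOn_deriv.mono_set hφΩ) (hd.mono_set hφΩ) ht
  simp only [mul_comm _ (φ _)] at hright
  exact tendsto_nhds_unique hleft
    (hright.neg.congr fun j => ((hst j).integral_eq φ hφ hφc hφΩ).symm)

variable [FiniteDimensional ℝ E] [μ.IsAddHaarMeasure]

theorem of_contDiff (Ω : Set E) (e : E) {ψ : E → ℝ} (hψ : ContDiff ℝ 1 ψ) :
    HasWeakDirDeriv μ Ω e ψ (fun x => fderiv ℝ ψ x e) := by
  have hloc {χ : E → ℝ} (hχ : Continuous χ) (U : Set E) : LocallyIntegrableOn χ U μ :=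
    hχ.locallyIntegrable.locallyIntegrableOn U
  have hd := continuous_fderiv_apply_const hψ e
  refine ⟨hloc hψ.continuous _, hloc hd _, fun φ hφ hφc hφΩ => ?_⟩
  rw [integral_mul_fderiv_eq_neg_fderiv_mul_of_integrable
    (integrable_mul_of_tsupport_subset (hloc hd _) hφ.continuous hφc hφΩ)
    (integrable_mul_fderiv_of_tsupport_subset (hloc hψ.continuous _) hφ hφc hφΩ e)
    (integrable_mul_of_tsupport_subset (hloc hψ.continuous _) hφ.continuous hφc hφΩ)
    (fun x _ => hψ.differentiable (by simp) x) (fun x _ => hφ.differentiable (by simp) x)]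
  simp only [mul_comm]

theorem comp (h : HasWeakDirDeriv μ Ω e v d) (hΩ : IsOpen Ω) {F : ℝ → ℝ} (hF : ContDiff ℝ 1 F)
    {C : NNReal} (hC : LipschitzWith C F) :
    HasWeakDirDeriv μ Ω e (fun x => F (v x)) (fun x => deriv F (v x) * d x) := by
  have hF' : Continuous (deriv F) := hF.continuous_deriv le_rfl
  have hF'C (t : ℝ) : |deriv F t| ≤ C := norm_deriv_le_of_lipschitz hC
  refine of_tendsto ((locallyIntegrableOn_iff hΩ.isLocallyClosed).2 fun K hKΩ hK => ?_)
    ((locallyIntegrableOn_iff hΩ.isLocallyClosed).2 fun K hKΩ hK => ?_) fun K hK hKΩ => ?_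
  · have hF0 : LipschitzWith C fun t => F t - F 0 := by
      simpa [LipschitzWith] using hC
    have hsub := memLp_one_iff_integrable.1
      (hF0.comp_memLp (sub_self _) (memLp_one_iff_integrable.2 (h.integrableOn hK hKΩ)))
    refine (hsub.add (integrableOn_const (C := F 0) hK.measure_lt_top.ne)).congr
      (Eventually.of_forall fun x => ?_)
    simp
  · exact (h.integrableOn_deriv hK hKΩ).bdd_mul
      (hF'.comp_aestronglyMeasurable (h.integrableOn hK hKΩ).aestronglyMeasurable)
      (Eventually.of_forall fun x => hF'C _)
  · obtain ⟨s, hs, hsv, hsv1, hsd⟩ := h.exists_smooth_approx hΩ hK hKΩ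
    refine ⟨fun j x => F (s j x), fun j x => deriv F (s j x) * fderiv ℝ (s j) x e,
      fun j => ?_, ?_, ?_⟩
    · have hchain (x : E) :
          deriv F (s j x) * fderiv ℝ (s j) x e = fderiv ℝ (fun x => F (s j x)) x e := by
        have hFx := (hF.differentiable one_ne_zero (s j x)).hasDerivAt
        have hder : HasFDerivAt (fun x => F (s j x)) (deriv F (s j x) • fderiv ℝ (s j) x) x :=
          hFx.comp_hasFDerivAt x ((hs j).differentiable (by simp) x).hasFDerivAt
        simp [hder.fderiv]
      simp_rw [hchain]
      exact of_contDiff Ω e (hF.comp ((hs j).of_le (by simp)))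
    · refine tendsto_of_tendsto_of_tendsto_of_le_of_le tendsto_const_nhds
        (by simpa using ENNReal.Tendsto.const_mul hsv1 (Or.inr (ENNReal.coe_ne_top (r := C))))
        (fun _ => zero_le) fun j => ?_
      rw [← lintegral_const_mul' _ _ ENNReal.coe_ne_top]
      exact lintegral_mono fun x => by simpa only [edist_eq_enorm_sub] using hC (s j x) (v x)
    · exact tendsto_lintegral_enorm_mul_sub_mul
        (fun j => (hF'.comp (hs j).continuous).aestronglyMeasurable) (fun j x => hF'C _)
        (hsv.mono fun x hx => (hF'.tendsto _).comp hx)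
        (fun j => (continuous_fderiv_apply_const
          ((hs j).of_le (by simp)) e).aestronglyMeasurable) (h.integrableOn_deriv hK hKΩ) hsd

theorem posPart (h : HasWeakDirDeriv μ Ω e v d) (hΩ : IsOpen Ω) :
    HasWeakDirDeriv μ Ω e (fun x => max (v x) 0) ({x | 0 < v x}.indicator d) := by
  set F : ℕ → ℝ → ℝ := fun j t => ∫ s in (0 : ℝ)..t, Real.smoothTransition (j * s)
  have hcont (j : ℕ) : Continuous fun t : ℝ => Real.smoothTransition (j * t) :=
    Real.smoothTransition.continuous.comp (continuous_const_mul _)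
  have hderiv (j : ℕ) : deriv (F j) = fun t => Real.smoothTransition (j * t) :=
    deriv_integral_smoothTransition_mul j
  have hF (j : ℕ) : ContDiff ℝ 1 (F j) := contDiff_integral_smoothTransition_mul j
  have hLip (j : ℕ) : LipschitzWith 1 (F j) := lipschitzWith_integral_smoothTransition_mul j
  have hFabs (j : ℕ) (t : ℝ) : ‖F j t‖ ≤ ‖t‖ := by simpa [F] using (hLip j).dist_le_mul t 0
  have hind : {x | 0 < v x}.indicator d = fun x => (Ioi (0 : ℝ)).indicator 1 (v x) * d x := by
    ext x
    by_cases hx : 0 < v x <;> simp [indicator, hx]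
  refine of_tendsto ((locallyIntegrableOn_iff hΩ.isLocallyClosed).2 fun K hKΩ hK => ?_)
    ((locallyIntegrableOn_iff hΩ.isLocallyClosed).2 fun K hKΩ hK => ?_) fun K hK hKΩ => ?_
  · exact (h.integrableOn hK hKΩ).pos_part
  · have hd := h.integrableOn_deriv hK hKΩ
    exact Integrable.mono hd (hd.aestronglyMeasurable.indicator₀ (nullMeasurableSet_lt
      aemeasurable_const (h.integrableOn hK hKΩ).aestronglyMeasurable.aemeasurable))
      (Eventually.of_forall fun x => norm_indicator_le_norm_self _ _)
  have hv := h.integrableOn hK hKΩ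
  have hd := h.integrableOn_deriv hK hKΩ
  refine ⟨fun j x => F j (v x), fun j x => deriv (F j) (v x) * d x,
    fun j => h.comp hΩ (hF j) (hLip j), ?_, ?_⟩
  · simp only [← ofReal_norm]
    exact tendsto_lintegral_norm_of_dominated_convergence (bound := fun x => ‖v x‖)
      (fun j => (hF j).continuous.comp_aestronglyMeasurable hv.aestronglyMeasurable)
      hv.norm.2 (fun j => Eventually.of_forall fun x => hFabs j _)
      (Eventually.of_forall fun x => tendsto_integral_smoothTransition_natCast_mul _)
  · simp only [hind, hderiv]
    exact tendsto_lintegral_enorm_mul_sub_mul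
      (fun j => (hcont j).comp_aestronglyMeasurable hv.aestronglyMeasurable)
      (fun j x => abs_smoothTransition_le_one _)
      (Eventually.of_forall fun x => tendsto_smoothTransition_natCast_mul _)
      (fun _ => hd.aestronglyMeasurable) hd (by simp)

end HasWeakDirDeriv

end WeakDerivative

section Translation

open scoped ContDiff ENNReal

theorem setLIntegral_ball_comp_add_le {E : Type*} [NormedAddCommGroup E] [MeasurableSpace E]
    [BorelSpace E] {μ : Measure E} [μ.IsAddRightInvariant] (g : E → ℝ≥0∞) {c h : E} {r R : ℝ}
    (hR : r + ‖h‖ ≤ R) :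
    ∫⁻ x in Metric.ball c r, g (x + h) ∂μ ≤ ∫⁻ x in Metric.closedBall c R, g x ∂μ := by
  rw [← (measurePreserving_add_right μ h).setLIntegral_comp_preimage_emb
    (measurableEmbedding_addRight h) g (Metric.closedBall c R)]
  refine lintegral_mono_set fun x hx => ?_
  rw [mem_preimage, mem_closedBall_iff_norm, add_sub_right_comm]
  exact (norm_add_le _ _).trans (by linarith [mem_ball_iff_norm.1 hx])

variable {E : Type*} [NormedAddCommGroup E] [NormedSpace ℝ E]

theorem enorm_translate_sub_le_of_contDiff {s : E → ℝ} (hs : ContDiff ℝ 1 s) (x h : E) :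
    ‖s (x + h) - s x‖ₑ ≤ ∫⁻ t in Ioc (0 : ℝ) 1, ‖fderiv ℝ s (x + t • h) h‖ₑ := by
  have hder (t : ℝ) : HasDerivAt (fun t : ℝ => s (x + t • h)) (fderiv ℝ s (x + t • h) h) t := by
    have hline : HasDerivAt (fun t : ℝ => x + t • h) h t := by
      simpa using ((hasDerivAt_id t).smul_const h).const_add x
    exact (hs.differentiable one_ne_zero _).hasFDerivAt.comp_hasDerivAt t hline
  have hcont : Continuous fun t : ℝ => fderiv ℝ s (x + t • h) h :=
    (continuous_fderiv_apply_const hs h).comp (by fun_prop)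
  have hFTC := intervalIntegral.integral_eq_sub_of_hasDerivAt (fun t _ => hder t)
    (hcont.intervalIntegrable 0 1)
  simp only [one_smul, zero_smul, add_zero] at hFTC
  rw [← hFTC, intervalIntegral.integral_of_le zero_le_one]
  exact enorm_integral_le_lintegral_enorm _

variable [MeasurableSpace E] [BorelSpace E] {μ : Measure E}
  [FiniteDimensional ℝ E] [μ.IsAddHaarMeasure]

theorem lintegral_enorm_translate_sub_le_of_contDiff {s : E → ℝ} (hs : ContDiff ℝ 1 s) (c h : E)
    (r : ℝ) : ∫⁻ x in Metric.ball c r, ‖s (x + h) - s x‖ₑ ∂μ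
      ≤ ∫⁻ x in Metric.closedBall c (r + ‖h‖), ‖fderiv ℝ s x h‖ₑ ∂μ := by
  have hjoint : Continuous fun q : E × ℝ => ‖fderiv ℝ s (q.1 + q.2 • h) h‖ₑ :=
    ((continuous_fderiv_apply_const hs h).comp (by fun_prop)).enorm
  calc ∫⁻ x in Metric.ball c r, ‖s (x + h) - s x‖ₑ ∂μ
      ≤ ∫⁻ x in Metric.ball c r, ∫⁻ t in Ioc (0 : ℝ) 1, ‖fderiv ℝ s (x + t • h) h‖ₑ ∂volume ∂μ :=
        lintegral_mono fun x => enorm_translate_sub_le_of_contDiff hs x h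
    _ = ∫⁻ t in Ioc (0 : ℝ) 1, ∫⁻ x in Metric.ball c r, ‖fderiv ℝ s (x + t • h) h‖ₑ ∂μ :=
        lintegral_lintegral_swap hjoint.measurable.aemeasurable
    _ ≤ ∫⁻ _ in Ioc (0 : ℝ) 1, ∫⁻ x in Metric.closedBall c (r + ‖h‖), ‖fderiv ℝ s x h‖ₑ ∂μ := by
        refine setLIntegral_mono' measurableSet_Ioc fun _ ht =>
          setLIntegral_ball_comp_add_le (fun x => ‖fderiv ℝ s x h‖ₑ) ?_
        rw [norm_smul, Real.norm_of_nonneg ht.1.le]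
        gcongr
        exact mul_le_of_le_one_left (norm_nonneg _) ht.2
    _ = ∫⁻ x in Metric.closedBall c (r + ‖h‖), ‖fderiv ℝ s x h‖ₑ ∂μ := by simp

theorem HasWeakDirDeriv.lintegral_enorm_translate_sub_le {Ω : Set E} {h : E} {f d : E → ℝ}
    (hf : HasWeakDirDeriv μ Ω h f d) (hΩ : IsOpen Ω) {c : E} {r : ℝ}
    (hr : Metric.closedBall c (r + ‖h‖) ⊆ Ω) :
    ∫⁻ x in Metric.ball c r, ‖f (x + h) - f x‖ₑ ∂μ
      ≤ ∫⁻ x in Metric.closedBall c (r + ‖h‖), ‖d x‖ₑ ∂μ := by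
  set K := Metric.closedBall c (r + ‖h‖)
  have hK : IsCompact K := isCompact_closedBall _ _
  obtain ⟨s, hs, hsf, -, hsd⟩ := hf.exists_smooth_approx hΩ hK hr
  have hs1 (j : ℕ) : ContDiff ℝ 1 (s j) := (hs j).of_le (by simp)
  rw [ae_restrict_iff' hK.measurableSet] at hsf
  have hlim : ∀ᵐ x ∂μ.restrict (Metric.ball c r),
      Tendsto (fun j => ‖s j (x + h) - s j x‖ₑ) atTop (𝓝 ‖f (x + h) - f x‖ₑ) := by
    rw [ae_restrict_iff' measurableSet_ball]
    filter_upwards [hsf, (measurePreserving_add_right μ h).quasiMeasurePreserving.ae hsf]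
      with x hx hxh hxr
    have hxr := mem_ball_iff_norm.1 hxr
    refine ((hxh ?_).sub (hx ?_)).enorm
    · rw [mem_closedBall_iff_norm, add_sub_right_comm]
      exact (norm_add_le _ _).trans (by gcongr)
    · exact mem_closedBall_iff_norm.2 (by linarith [norm_nonneg h])
  have hbound (j : ℕ) : ∫⁻ x in Metric.ball c r, ‖s j (x + h) - s j x‖ₑ ∂μ
      ≤ ∫⁻ x in K, ‖fderiv ℝ (s j) x h - d x‖ₑ ∂μ + ∫⁻ x in K, ‖d x‖ₑ ∂μ := by
    refine (lintegral_enorm_translate_sub_le_of_contDiff (hs1 j) c h r).trans ?_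
    rw [← lintegral_add_right' _ (hf.integrableOn_deriv hK hr).aestronglyMeasurable.enorm]
    exact lintegral_mono fun x => (enorm_add_le _ _).trans_eq' (by rw [sub_add_cancel])
  calc ∫⁻ x in Metric.ball c r, ‖f (x + h) - f x‖ₑ ∂μ
      = ∫⁻ x in Metric.ball c r, liminf (fun j => ‖s j (x + h) - s j x‖ₑ) atTop ∂μ :=
        lintegral_congr_ae (hlim.mono fun x hx => hx.liminf_eq.symm)
    _ ≤ liminf (fun j => ∫⁻ x in Metric.ball c r, ‖s j (x + h) - s j x‖ₑ ∂μ) atTop :=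
        lintegral_liminf_le fun j =>
          (((hs1 j).continuous.comp (continuous_add_const h)).sub
            (hs1 j).continuous).measurable.enorm
    _ ≤ liminf (fun j => ∫⁻ x in K, ‖fderiv ℝ (s j) x h - d x‖ₑ ∂μ + ∫⁻ x in K, ‖d x‖ₑ ∂μ)
        atTop := liminf_le_liminf (Eventually.of_forall hbound)
    _ = ∫⁻ x in K, ‖d x‖ₑ ∂μ := by
        simpa using (hsd.add_const (∫⁻ x in K, ‖d x‖ₑ ∂μ)).liminf_eq

end Translation

section WeakGradient

open scoped ContDiff ENNReal

section Truncation

variable {E : Type*} [NormedAddCommGroup E] [InnerProductSpace ℝ E] [MeasurableSpace E]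

/-- `v` has the weak gradient `g` in `Ω`, both locally integrable in `Ω`. -/
def HasWeakGrad (μ : Measure E) (Ω : Set E) (v : E → ℝ) (g : E → E) : Prop :=
  ∀ e, HasWeakDirDeriv μ Ω e v fun x => inner ℝ (g x) e

namespace HasWeakGrad

variable [BorelSpace E] {μ : Measure E} {Ω : Set E} {f f' : E → ℝ} {G G' : E → E}

theorem sub (h : HasWeakGrad μ Ω f G) (h' : HasWeakGrad μ Ω f' G') :
    HasWeakGrad μ Ω (fun x => f x - f' x) (fun x => G x - G' x) := fun e => by
  simpa only [inner_sub_left] using (h e).sub (h' e)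

variable [FiniteDimensional ℝ E] [μ.IsAddHaarMeasure]

theorem of_contDiff (Ω : Set E) {ψ : E → ℝ} (hψ : ContDiff ℝ 1 ψ) :
    HasWeakGrad μ Ω ψ (gradient ψ) := fun e => by
  simpa only [inner_gradient_left] using HasWeakDirDeriv.of_contDiff Ω e hψ

theorem const_sub (h : HasWeakGrad μ Ω f G) (a : ℝ) :
    HasWeakGrad μ Ω (fun x => a - f x) (fun x => -G x) := by
  simpa only [gradient_fun_const, zero_sub] using
    (of_contDiff Ω (contDiff_const (c := a))).sub h

theorem posPart (h : HasWeakGrad μ Ω f G) (hΩ : IsOpen Ω) :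
    HasWeakGrad μ Ω (fun x => max (f x) 0) ({x | 0 < f x}.indicator G) := fun e => by
  convert (h e).posPart hΩ using 1
  ext x
  by_cases hx : 0 < f x <;> simp [indicator, hx]

open Classical in
theorem inf (h : HasWeakGrad μ Ω f G) (h' : HasWeakGrad μ Ω f' G') (hΩ : IsOpen Ω) :
    HasWeakGrad μ Ω (fun x => min (f x) (f' x)) ({x | f' x < f x}.piecewise G' G) := by
  convert h.sub ((h.sub h').posPart hΩ) using 1 <;> ext1 x
  · rcases le_total (f x) (f' x) with hx | hx <;> simp [hx]
  · by_cases hx : f' x < f x <;> simp [piecewise, indicator, hx]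

theorem truncate (h : HasWeakGrad μ Ω f G) (hΩ : IsOpen Ω) {a b : ℝ} (hab : a ≤ b) :
    HasWeakGrad μ Ω (fun x => max (b - f x) 0 - max (a - f x) 0)
      ({x | a ≤ f x ∧ f x < b}.indicator fun x => -G x) := by
  convert ((h.const_sub b).posPart hΩ).sub ((h.const_sub a).posPart hΩ) using 1
  ext1 x
  by_cases ha : f x < a
  · simp [indicator, ha, ha.trans_le hab, ha.not_ge]
  · simp [indicator, ha, not_lt.1 ha]

end HasWeakGrad

end Truncation

section Increments

variable {E : Type*} [NormedAddCommGroup E] [MeasurableSpace E] [BorelSpace E] {μ : Measure E}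
  {f : E → ℝ}

theorem ofReal_mul_measure_mul_measure_le [μ.IsAddLeftInvariant] {c : E} {r t : ℝ} {A B : Set E}
    (hA : MeasurableSet A) (hB : MeasurableSet B) (hAr : A ⊆ Metric.ball c r)
    (hBr : B ⊆ Metric.ball c r) (ht : ∀ x ∈ A, ∀ y ∈ B, t ≤ |f y - f x|) :
    ENNReal.ofReal t * μ A * μ B
      ≤ ∫⁻ x in Metric.ball c r, ∫⁻ h in Metric.ball 0 (2 * r), ‖f (x + h) - f x‖ₑ ∂μ ∂μ := by
  calc ENNReal.ofReal t * μ A * μ B = ∫⁻ _ in A, ENNReal.ofReal t * μ B ∂μ := by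
        rw [setLIntegral_const, mul_right_comm]
    _ ≤ ∫⁻ x in A, ∫⁻ h in Metric.ball 0 (2 * r), ‖f (x + h) - f x‖ₑ ∂μ ∂μ := by
        refine setLIntegral_mono' hA fun x hx => ?_
        have hBx : (fun h => x + h) ⁻¹' B ⊆ Metric.ball 0 (2 * r) := by
          intro h hh
          have hdist := dist_triangle_right (x + h) x c
          rw [dist_self_add_left] at hdist
          rw [mem_ball_zero_iff]
          linarith [Metric.mem_ball.1 (hBr hh), Metric.mem_ball.1 (hAr hx)]
        rw [← measure_preimage_add μ x B, ← setLIntegral_const]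
        refine (setLIntegral_mono' (measurable_const_add x hB) fun h hh => ?_).trans
          (lintegral_mono_set hBx)
        rw [← ofReal_norm]
        exact ENNReal.ofReal_le_ofReal (ht x hx _ hh)
    _ ≤ _ := lintegral_mono_set hAr

theorem half_measure_mul_enorm_le [μ.IsAddLeftInvariant] (hf : Measurable f) {S : Set E}
    (hS : MeasurableSet S) (hSt : μ S ≠ ⊤) (hsupp : μ (Function.support f) ≤ μ S / 2) (x : E) :
    μ S / 2 * ‖f x‖ₑ ≤ ∫⁻ h in S, ‖f (x + h) - f x‖ₑ ∂μ := by
  set Z : Set E := (fun h => x + h) ⁻¹' Function.support f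
  have hZ : MeasurableSet Z := measurable_const_add x (measurableSet_support hf)
  have hhalf : μ S / 2 ≤ μ (S \ Z) := calc
    μ S / 2 = μ S - μ S / 2 := (ENNReal.sub_half hSt).symm
    _ ≤ μ S - μ Z := by
      gcongr
      exact (measure_preimage_add μ x _).trans_le hsupp
    _ ≤ μ (S \ Z) := le_measure_sdiff
  calc μ S / 2 * ‖f x‖ₑ ≤ ∫⁻ _ in S \ Z, ‖f x‖ₑ ∂μ := by
        rw [setLIntegral_const, mul_comm]
        gcongr
    _ = ∫⁻ h in S \ Z, ‖f (x + h) - f x‖ₑ ∂μ := by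
        refine setLIntegral_congr_fun (hS.diff hZ) fun h hh => ?_
        have hfh : f (x + h) = 0 := Function.notMem_support.1 hh.2
        rw [hfh, zero_sub, enorm_neg]
    _ ≤ ∫⁻ h in S, ‖f (x + h) - f x‖ₑ ∂μ := lintegral_mono_set sdiff_subset

end Increments

namespace HasWeakGrad

variable {E : Type*} [NormedAddCommGroup E] [InnerProductSpace ℝ E] [FiniteDimensional ℝ E]
  [MeasurableSpace E] [BorelSpace E] {μ : Measure E} [μ.IsAddHaarMeasure] {Ω : Set E} {f : E → ℝ}
  {G : E → E} {c : E} {r ρ : ℝ}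

theorem lintegral_lintegral_translate_sub_le (hf : HasWeakGrad μ Ω f G) (hΩ : IsOpen Ω)
    (hfm : Measurable f) (hr : Metric.closedBall c (r + ρ) ⊆ Ω) :
    ∫⁻ x in Metric.ball c r, ∫⁻ h in Metric.ball 0 ρ, ‖f (x + h) - f x‖ₑ ∂μ ∂μ
      ≤ μ (Metric.ball 0 ρ) *
        (ENNReal.ofReal ρ * ∫⁻ x in Metric.closedBall c (r + ρ), ‖G x‖ₑ ∂μ) := by
  have hmeas : Measurable (Function.uncurry fun x h : E => ‖f (x + h) - f x‖ₑ) :=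
    ((hfm.comp (measurable_fst.add measurable_snd)).sub (hfm.comp measurable_fst)).enorm
  rw [lintegral_lintegral_swap hmeas.aemeasurable, mul_comm (μ _), ← setLIntegral_const]
  refine setLIntegral_mono' measurableSet_ball fun h hh => ?_
  rw [mem_ball_zero_iff] at hh
  have hsub : Metric.closedBall c (r + ‖h‖) ⊆ Metric.closedBall c (r + ρ) :=
    Metric.closedBall_subset_closedBall (by gcongr)
  refine ((hf h).lintegral_enorm_translate_sub_le hΩ (hsub.trans hr)).trans ?_
  rw [← lintegral_const_mul' _ _ ENNReal.ofReal_ne_top]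
  refine (lintegral_mono_set hsub).trans (lintegral_mono fun x => ?_)
  rw [← ofReal_norm, ← ofReal_norm, ← ENNReal.ofReal_mul ((norm_nonneg h).trans hh.le), mul_comm]
  refine ENNReal.ofReal_le_ofReal ((norm_inner_le_norm _ _).trans ?_)
  gcongr

theorem lintegral_enorm_le_of_measure_support_le (hf : HasWeakGrad μ Ω f G) (hΩ : IsOpen Ω)
    (hfm : Measurable f) (hρ : 0 < ρ) (hr : Metric.closedBall c (r + ρ) ⊆ Ω)
    (hsupp : μ (Function.support f) ≤ μ (Metric.ball 0 ρ) / 2) :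
    ∫⁻ x in Metric.ball c r, ‖f x‖ₑ ∂μ
      ≤ 2 * (ENNReal.ofReal ρ * ∫⁻ x in Metric.closedBall c (r + ρ), ‖G x‖ₑ ∂μ) := by
  set M := μ (Metric.ball (0 : E) ρ)
  have hM0 : M / 2 ≠ 0 := (ENNReal.half_pos (Metric.measure_ball_pos μ 0 hρ).ne').ne'
  have hMt : M / 2 ≠ ⊤ := ENNReal.div_ne_top measure_ball_lt_top.ne two_ne_zero
  refine (ENNReal.mul_le_mul_iff_right hM0 hMt).1 ?_
  rw [← lintegral_const_mul' _ _ hMt, ← mul_assoc (M / 2), ENNReal.div_mul_cancel two_ne_zero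
    ENNReal.ofNat_ne_top]
  exact (lintegral_mono fun x => half_measure_mul_enorm_le hfm measurableSet_ball
    measure_ball_lt_top.ne hsupp x).trans
      (hf.lintegral_lintegral_translate_sub_le hΩ hfm hr)

theorem deGiorgi_isoperimetric (hf : HasWeakGrad μ Ω f G) (hΩ : IsOpen Ω)
    (hfm : Measurable f) (hr : Metric.closedBall c (3 * r) ⊆ Ω) {a b : ℝ} (hab : a ≤ b) :
    ENNReal.ofReal (b - a) * μ (Metric.ball c r ∩ {x | f x < a}) *
        μ (Metric.ball c r ∩ {x | b ≤ f x}) ≤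
      μ (Metric.ball 0 (2 * r)) * (ENNReal.ofReal (2 * r) *
        ∫⁻ x in Metric.closedBall c (3 * r) ∩ {x | a ≤ f x ∧ f x < b}, ‖G x‖ₑ ∂μ) := by
  have hr3 : r + 2 * r = 3 * r := by ring
  have hlevel : MeasurableSet {x | a ≤ f x ∧ f x < b} :=
    (measurableSet_le measurable_const hfm).inter (measurableSet_lt hfm measurable_const)
  have hjump : ∀ x ∈ Metric.ball c r ∩ {x | f x < a}, ∀ y ∈ Metric.ball c r ∩ {x | b ≤ f x},
      b - a ≤ |(max (b - f y) 0 - max (a - f y) 0) - (max (b - f x) 0 - max (a - f x) 0)| := by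
    rintro x ⟨-, hx : f x < a⟩ y ⟨-, hy : b ≤ f y⟩
    rw [max_eq_right (by linarith), max_eq_right (by linarith), max_eq_left (by linarith),
      max_eq_left (by linarith), abs_sub_comm]
    exact (le_abs_self _).trans' (by linarith)
  refine (ofReal_mul_measure_mul_measure_le (measurableSet_ball.inter
    (measurableSet_lt hfm measurable_const)) (measurableSet_ball.inter
    (measurableSet_le measurable_const hfm)) inter_subset_left inter_subset_left hjump).trans ?_
  refine ((hf.truncate hΩ hab).lintegral_lintegral_translate_sub_le hΩ (by fun_prop)
    (by rwa [hr3])).trans_eq ?_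
  simp only [hr3, enorm_indicator_eq_indicator_enorm, enorm_neg]
  rw [setLIntegral_indicator hlevel, inter_comm]

end HasWeakGrad

end WeakGradient

section DeGiorgi

open scoped ContDiff ENNReal NNReal

section Young

theorem le_rpow_add_one {p : ℝ} (hp : 1 ≤ p) {t : ℝ} (ht : 0 ≤ t) : t ≤ t ^ p + 1 := by
  rcases le_total t 1 with h | h
  · linarith [Real.rpow_nonneg ht p]
  · have := Real.rpow_le_rpow_of_exponent_le h hp
    rw [Real.rpow_one] at this
    linarith

theorem exists_le_mul_rpow_add {p : ℝ} (hp : 1 < p) {ε : ℝ} (hε : 0 < ε) :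
    ∃ C : ℝ, 0 < C ∧ ∀ t : ℝ, 0 ≤ t → t ≤ ε * t ^ p + C := by
  have hlim : Tendsto (fun t : ℝ => ε * t ^ (p - 1)) atTop atTop :=
    (tendsto_rpow_atTop (sub_pos.2 hp)).const_mul_atTop hε
  obtain ⟨C, hC⟩ := (hlim.eventually_ge_atTop 1).exists_forall_of_atTop
  refine ⟨max C 1, by positivity, fun t ht => ?_⟩
  rcases le_total t (max C 1) with h | h
  · linarith [mul_nonneg hε.le (Real.rpow_nonneg ht p)]
  · have ht0 : 0 < t := zero_lt_one.trans_le ((le_max_right _ _).trans h)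
    calc t ≤ ε * t ^ (p - 1) * t :=
          le_mul_of_one_le_left ht (hC t ((le_max_left _ _).trans h))
      _ = ε * t ^ p := by rw [mul_assoc, ← Real.rpow_add_one ht0.ne', sub_add_cancel]
      _ ≤ ε * t ^ p + max C 1 := le_add_of_nonneg_right (by positivity)

theorem exists_le_mul_rpow_add_of_mul_lt {p : ℝ} (hp : 1 < p) {M A κ : ℝ} (hM : 0 < M)
    (hA : 0 ≤ A) (hκ : 0 < κ) :
    ∃ ε C δ : ℝ, 0 < ε ∧ 0 < C ∧ 0 < δ ∧ (∀ t : ℝ, 0 ≤ t → t ≤ ε * t ^ p + C) ∧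
      M * (ε * A + C * δ) < κ := by
  have hε : 0 < κ / (2 * M * (A + 1)) := by positivity
  obtain ⟨C, hC, hY⟩ := exists_le_mul_rpow_add hp hε
  refine ⟨_, C, κ / (2 * M * C), hε, hC, by positivity, hY, ?_⟩
  calc M * (κ / (2 * M * (A + 1)) * A + C * (κ / (2 * M * C)))
      = κ - κ / (2 * (A + 1)) := by
        field_simp
        ring
    _ < κ := sub_lt_self _ (by positivity)

end Young

variable {E : Type*} [NormedAddCommGroup E] [InnerProductSpace ℝ E]

/-- `ψ` is a smooth function with values at most `k`, nonpositive outside the ball of radius `s`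
about `c`, and with Lipschitz constant at most `k * L`. The sets `{w < ψ}` are localized
sublevel sets of a nonnegative function `w`. -/
structure IsBarrier (c : E) (s k L : ℝ) (ψ : E → ℝ) : Prop where
  contDiff : ContDiff ℝ ∞ ψ
  le : ∀ x, ψ x ≤ k
  nonpos : ∀ x ∉ Metric.ball c s, ψ x ≤ 0
  norm_fderiv_le : ∀ x, ‖fderiv ℝ ψ x‖ ≤ k * L

namespace IsBarrier

variable {c : E} {s k L : ℝ} {ψ w : E → ℝ}

theorem const_mul_sub {η : E → ℝ} (hη : IsBarrier c s 1 L η) {a : ℝ} (hk : 0 ≤ k) (ha : 0 ≤ a) :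
    IsBarrier c s k L fun x => k * η x - a where
  contDiff := (contDiff_const.mul hη.contDiff).sub contDiff_const
  le x := by nlinarith [hη.le x]
  nonpos x hx := by nlinarith [hη.nonpos x hx]
  norm_fderiv_le x := by
    rw [fderiv_sub_const, fderiv_const_mul (hη.contDiff.differentiable (by simp) x), norm_smul,
      Real.norm_of_nonneg hk]
    gcongr
    simpa using hη.norm_fderiv_le x

theorem sublevel_subset_ball (hψ : IsBarrier c s k L ψ) (hw : ∀ x, 0 ≤ w x) :
    {x | w x < ψ x} ⊆ Metric.ball c s := fun x hx => by
  by_contra hxs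
  exact (hw x).not_gt (lt_of_lt_of_le hx (hψ.nonpos x hxs))

theorem nonneg (hψ : IsBarrier c s k L ψ) (hk : 0 < k) : 0 ≤ L :=
  nonneg_of_mul_nonneg_right ((norm_nonneg _).trans (hψ.norm_fderiv_le c)) hk

theorem norm_gradient_le [CompleteSpace E] (hψ : IsBarrier c s k L ψ) (x : E) :
    ‖gradient ψ x‖ ≤ k * L := by
  rw [gradient, LinearIsometryEquiv.norm_map]
  exact hψ.norm_fderiv_le x

end IsBarrier

theorem exists_isBarrier_eq_one [FiniteDimensional ℝ E] (c : E) {s' s : ℝ} (hs' : 0 < s')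
    (hs : s' < s) :
    ∃ (η : E → ℝ) (L : ℝ), IsBarrier c s 1 L η ∧ ∀ x ∈ Metric.closedBall c s', η x = 1 := by
  set η : ContDiffBump c := ⟨s', s, hs', hs⟩
  obtain ⟨L, hL⟩ := ((η.contDiff (n := 1)).continuous_fderiv one_ne_zero
    ).bounded_above_of_compact_support (η.hasCompactSupport.fderiv ℝ)
  exact ⟨η, L, ⟨η.contDiff, fun x => η.le_one, fun x hx => (η.zero_of_le_dist (not_lt.1 hx)).le,
    by simpa using hL⟩, fun x hx => η.one_of_mem_closedBall hx⟩

variable [MeasurableSpace E]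

/-- The De Giorgi class of nonnegative functions `w`, with weak gradient `g`, whose `p`-energy
below a barrier of height `k ≤ 1` is at most `Λ L * k ^ p` times the measure of the set where `w`
is below the barrier. -/
structure IsDeGiorgiClass (μ : Measure E) (p : ℝ) (Λ : ℝ → ℝ≥0) (Ω : Set E) (w : E → ℝ)
    (g : E → E) : Prop where
  measurable : Measurable w
  measurable_grad : Measurable g
  nonneg : ∀ x, 0 ≤ w x
  hasWeakGrad : HasWeakGrad μ Ω w g
  lintegral_rpow_le : ∀ {c : E} {s k L : ℝ} {ψ : E → ℝ}, IsBarrier c s k L ψ →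
    Metric.closedBall c s ⊆ Ω → 0 < k → k ≤ 1 →
    ∫⁻ x in {x | w x < ψ x}, ENNReal.ofReal (‖g x‖ ^ p) ∂μ
      ≤ ENNReal.ofReal (Λ L * k ^ p) * μ {x | w x < ψ x}

namespace IsDeGiorgiClass

variable {μ : Measure E} {p : ℝ} {Λ : ℝ → ℝ≥0} {Ω : Set E} {w : E → ℝ} {g : E → E}
  {c : E} {s k L : ℝ} {ψ : E → ℝ}

theorem measurableSet_lt_barrier [BorelSpace E] (hw : IsDeGiorgiClass μ p Λ Ω w g)
    (hψ : IsBarrier c s k L ψ) : MeasurableSet {x | w x < ψ x} :=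
  measurableSet_lt hw.measurable hψ.contDiff.continuous.measurable

theorem lintegral_enorm_le (hw : IsDeGiorgiClass μ p Λ Ω w g) (hψ : IsBarrier c s k L ψ)
    (hs : Metric.closedBall c s ⊆ Ω) (hk0 : 0 < k) (hk1 : k ≤ 1) {S : Set E}
    (hS : S ⊆ {x | w x < ψ x}) {ε C : ℝ} (hε : 0 ≤ ε) (hC : 0 ≤ C)
    (hY : ∀ t : ℝ, 0 ≤ t → t ≤ ε * t ^ p + C) :
    ∫⁻ x in S, ‖g x‖ₑ ∂μ ≤ ENNReal.ofReal k *
      (ENNReal.ofReal (ε * Λ L) * μ {x | w x < ψ x} + ENNReal.ofReal C * μ S) := by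
  have hpt : ∀ x, ‖g x‖ₑ ≤ ENNReal.ofReal k *
      (ENNReal.ofReal (ε * (k ^ p)⁻¹) * ENNReal.ofReal (‖g x‖ ^ p) + ENNReal.ofReal C) := by
    intro x
    have hYk := hY (‖g x‖ / k) (by positivity)
    rw [Real.div_rpow (norm_nonneg _) hk0.le, div_le_iff₀ hk0] at hYk
    rw [← ofReal_norm, ← ENNReal.ofReal_mul (by positivity),
      ← ENNReal.ofReal_add (by positivity) hC, ← ENNReal.ofReal_mul hk0.le]
    exact ENNReal.ofReal_le_ofReal (hYk.trans_eq (by ring))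
  calc ∫⁻ x in S, ‖g x‖ₑ ∂μ
      ≤ ENNReal.ofReal k * (ENNReal.ofReal (ε * (k ^ p)⁻¹) *
          (∫⁻ x in S, ENNReal.ofReal (‖g x‖ ^ p) ∂μ) + ENNReal.ofReal C * μ S) := by
        refine (lintegral_mono hpt).trans_eq ?_
        rw [lintegral_const_mul' _ _ ENNReal.ofReal_ne_top,
          lintegral_add_right _ measurable_const, lintegral_const_mul' _ _ ENNReal.ofReal_ne_top,
          setLIntegral_const]
    _ ≤ ENNReal.ofReal k * (ENNReal.ofReal (ε * (k ^ p)⁻¹) *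
          (ENNReal.ofReal (Λ L * k ^ p) * μ {x | w x < ψ x}) + ENNReal.ofReal C * μ S) := by
        gcongr
        exact (lintegral_mono_set hS).trans (hw.lintegral_rpow_le hψ hs hk0 hk1)
    _ = _ := by
        have : 0 < k ^ p := by positivity
        rw [← mul_assoc (ENNReal.ofReal (ε * (k ^ p)⁻¹)), ← ENNReal.ofReal_mul (by positivity)]
        congr 4
        field_simp

theorem lintegral_enorm_gradient_sub_le [CompleteSpace E] (hw : IsDeGiorgiClass μ p Λ Ω w g)
    (hp : 1 ≤ p) (hψ : IsBarrier c s k L ψ) (hs : Metric.closedBall c s ⊆ Ω) (hk0 : 0 < k)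
    (hk1 : k ≤ 1) :
    ∫⁻ x in {x | w x < ψ x}, ‖gradient ψ x - g x‖ₑ ∂μ
      ≤ ENNReal.ofReal (k * (L + Λ L + 1)) * μ {x | w x < ψ x} := by
  have hL := hψ.nonneg hk0
  have hgrad : ∀ x, ‖gradient ψ x‖ₑ ≤ ENNReal.ofReal (k * L) := fun x => by
    rw [← ofReal_norm]
    exact ENNReal.ofReal_le_ofReal (hψ.norm_gradient_le x)
  have hg := hw.lintegral_enorm_le hψ hs hk0 hk1 subset_rfl zero_le_one zero_le_one
    fun t ht => by simpa using le_rpow_add_one hp ht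
  calc ∫⁻ x in {x | w x < ψ x}, ‖gradient ψ x - g x‖ₑ ∂μ
      ≤ ∫⁻ x in {x | w x < ψ x}, (ENNReal.ofReal (k * L) + ‖g x‖ₑ) ∂μ :=
        lintegral_mono fun x => (enorm_sub_le).trans (by gcongr; exact hgrad x)
    _ = ENNReal.ofReal (k * L) * μ {x | w x < ψ x} + ∫⁻ x in {x | w x < ψ x}, ‖g x‖ₑ ∂μ := by
        rw [lintegral_add_left measurable_const, setLIntegral_const]
    _ ≤ _ := add_le_add le_rfl hg
    _ = _ := by
        rw [← add_mul, ← ENNReal.ofReal_add (by positivity) zero_le_one, ← mul_assoc,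
          ← ENNReal.ofReal_mul hk0.le, ← add_mul,
          ← ENNReal.ofReal_add (by positivity) (by positivity)]
        congr 2
        ring

variable [BorelSpace E] [FiniteDimensional ℝ E] [μ.IsAddHaarMeasure] {ρ : ℝ}

theorem lintegral_enorm_posPart_sub_le (hw : IsDeGiorgiClass μ p Λ Ω w g) (hp : 1 ≤ p)
    (hΩ : IsOpen Ω) (hψ : IsBarrier c s k L ψ) (hρ : 0 < ρ)
    (hs : Metric.closedBall c (s + ρ) ⊆ Ω) (hk0 : 0 < k) (hk1 : k ≤ 1)
    (hsmall : μ {x | w x < ψ x} ≤ μ (Metric.ball 0 ρ) / 2) :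
    ∫⁻ x in Metric.ball c s, ‖max (ψ x - w x) 0‖ₑ ∂μ
      ≤ ENNReal.ofReal (2 * ρ * k * (L + Λ L + 1)) * μ {x | w x < ψ x} := by
  have hψm : Measurable ψ := hψ.contDiff.continuous.measurable
  have hwm := hw.measurable
  have hpos : {x | 0 < ψ x - w x} = {x | w x < ψ x} := by simp only [sub_pos]
  have hsupp : Function.support (fun x => max (ψ x - w x) 0) ⊆ {x | w x < ψ x} := fun x hx => by
    contrapose! hx
    simpa using hx
  have hweak := ((HasWeakGrad.of_contDiff (μ := μ) Ω (hψ.contDiff.of_le (by simp))).sub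
    hw.hasWeakGrad).posPart hΩ
  have hgrad := hw.lintegral_enorm_gradient_sub_le hp hψ
    ((Metric.closedBall_subset_closedBall (by linarith)).trans hs) hk0 hk1
  refine (hweak.lintegral_enorm_le_of_measure_support_le hΩ (by fun_prop) hρ hs
    ((measure_mono hsupp).trans hsmall)).trans ?_
  simp only [enorm_indicator_eq_indicator_enorm, hpos]
  calc 2 * (ENNReal.ofReal ρ * ∫⁻ x in Metric.closedBall c (s + ρ),
        {x | w x < ψ x}.indicator (fun x => ‖gradient ψ x - g x‖ₑ) x ∂μ)
      ≤ 2 * (ENNReal.ofReal ρ *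
          (ENNReal.ofReal (k * (L + Λ L + 1)) * μ {x | w x < ψ x})) := by
        gcongr
        refine (setLIntegral_le_lintegral _ _).trans ?_
        rwa [lintegral_indicator (hw.measurableSet_lt_barrier hψ)]
    _ = _ := by
        rw [← ENNReal.ofReal_ofNat 2, ← mul_assoc, ← mul_assoc, ← ENNReal.ofReal_mul zero_le_two,
          ← ENNReal.ofReal_mul (by positivity)]
        congr 2
        ring

theorem ofReal_mul_measure_lt_sub_le (hw : IsDeGiorgiClass μ p Λ Ω w g) (hp : 1 ≤ p)
    (hΩ : IsOpen Ω) (hψ : IsBarrier c s k L ψ) (hρ : 0 < ρ)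
    (hs : Metric.closedBall c (s + ρ) ⊆ Ω) (hk0 : 0 < k) (hk1 : k ≤ 1)
    (hsmall : μ {x | w x < ψ x} ≤ μ (Metric.ball 0 ρ) / 2) {δ : ℝ} (hδ : 0 ≤ δ) :
    ENNReal.ofReal δ * μ {x | w x < ψ x - δ}
      ≤ ENNReal.ofReal (2 * ρ * k * (L + Λ L + 1)) * μ {x | w x < ψ x} := by
  have hlt : ∀ x, w x < ψ x - δ → ENNReal.ofReal δ ≤ ‖max (ψ x - w x) 0‖ₑ := fun x hx => by
    rw [← ofReal_norm]
    exact ENNReal.ofReal_le_ofReal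
      (((by linarith : δ ≤ ψ x - w x).trans (le_max_left _ _)).trans (le_abs_self _))
  have hball : {x | w x < ψ x - δ} ⊆ Metric.ball c s := fun x (hx : w x < ψ x - δ) =>
    hψ.sublevel_subset_ball hw.nonneg (hx.trans_le (sub_le_self _ hδ))
  rw [← setLIntegral_const]
  exact (setLIntegral_mono' (measurableSet_lt hw.measurable
    (hψ.contDiff.continuous.measurable.sub_const δ)) hlt).trans <|
      (lintegral_mono_set hball).trans
        (hw.lintegral_enorm_posPart_sub_le hp hΩ hψ hρ hs hk0 hk1 hsmall)

end IsDeGiorgiClass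

end DeGiorgi

section Density

open scoped ContDiff ENNReal NNReal

section Balls

variable {E : Type*} [NormedAddCommGroup E] [NormedSpace ℝ E] [FiniteDimensional ℝ E]
  [MeasurableSpace E] [BorelSpace E] (μ : Measure E) [μ.IsAddHaarMeasure]

theorem measure_ball_half (c : E) (ρ : ℝ) :
    μ (Metric.ball c (ρ / 2))
      = ENNReal.ofReal ((1 / 2) ^ Module.finrank ℝ E) * μ (Metric.ball 0 ρ) := by
  rw [div_eq_inv_mul, ← one_div, Measure.addHaar_ball_mul_of_pos μ c one_half_pos ρ]

theorem tendsto_measure_ball_zero [Nontrivial E] (c : E) {ρ : ℕ → ℝ} (hρ : ∀ j, 0 ≤ ρ j)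
    (hlim : Tendsto ρ atTop (𝓝 0)) : Tendsto (fun j => μ (Metric.ball c (ρ j))) atTop (𝓝 0) := by
  have hpow := ENNReal.tendsto_ofReal (hlim.pow (Module.finrank ℝ E))
  rw [zero_pow Module.finrank_pos.ne', ENNReal.ofReal_zero] at hpow
  have hmul := ENNReal.Tendsto.mul_const (b := μ (Metric.ball 0 1)) hpow
    (Or.inr measure_ball_lt_top.ne)
  rw [zero_mul] at hmul
  exact hmul.congr fun j => (Measure.addHaar_ball μ c (hρ j)).symm

end Balls

theorem exists_measure_preimage_Ico_lt {α : Type*} [MeasurableSpace α] {μ : Measure α}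
    {w : α → ℝ} (hw : Measurable w) {a : ℕ → ℝ} (ha : Antitone a) {J : ℕ} {δ : ℝ≥0∞}
    (hJ : μ univ < J * δ) : ∃ j < J, μ (w ⁻¹' Ico (a (j + 1)) (a j)) < δ := by
  have hdisj : (Finset.range J : Set ℕ).PairwiseDisjoint fun j => w ⁻¹' Ico (a (j + 1)) (a j) :=
    fun i _ j _ hij => (ha.pairwise_disjoint_on_Ico_succ hij).preimage w
  have hsum : ∑ j ∈ Finset.range J, μ (w ⁻¹' Ico (a (j + 1)) (a j))
      < ∑ _j ∈ Finset.range J, δ := by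
    rw [← measure_biUnion_finset hdisj fun j _ => hw measurableSet_Ico, Finset.sum_const,
      Finset.card_range, nsmul_eq_mul]
    exact (measure_mono (subset_univ _)).trans_lt hJ
  obtain ⟨j, hj, hlt⟩ := Finset.exists_lt_of_sum_lt hsum
  exact ⟨j, Finset.mem_range.1 hj, hlt⟩

namespace IsDeGiorgiClass

variable {E : Type*} [NormedAddCommGroup E] [InnerProductSpace ℝ E] [FiniteDimensional ℝ E]
  [MeasurableSpace E] [BorelSpace E] {μ : Measure E} [μ.IsAddHaarMeasure] {p : ℝ}
  {Λ : ℝ → ℝ≥0} {Ω : Set E} {w : E → ℝ} {g : E → E} {c : E}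

theorem measure_lt_sub_le_half (hw : IsDeGiorgiClass μ p Λ Ω w g) (hp : 1 ≤ p) (hΩ : IsOpen Ω)
    {ψ : E → ℝ} {s ρ L k δ : ℝ} (hψ : IsBarrier c s k L ψ) (hρ : 0 < ρ)
    (hs : Metric.closedBall c (s + ρ) ⊆ Ω) (hk0 : 0 < k) (hk1 : k ≤ 1)
    (hsmall : μ {x | w x < ψ x} ≤ μ (Metric.ball 0 ρ) / 2) (hδ : 0 < δ)
    (hδρ : 2 * ρ * k * (L + Λ L + 1) ≤ δ * (1 / 2) ^ Module.finrank ℝ E) :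
    μ {x | w x < ψ x - δ} ≤ μ (Metric.ball 0 (ρ / 2)) / 2 := by
  have hstep := (hw.ofReal_mul_measure_lt_sub_le hp hΩ hψ hρ hs hk0 hk1 hsmall hδ.le).trans
    (mul_le_mul_left (ENNReal.ofReal_le_ofReal hδρ) _)
  rw [ENNReal.ofReal_mul hδ.le, mul_assoc] at hstep
  have hmeas := (ENNReal.mul_le_mul_iff_right (ENNReal.ofReal_pos.2 hδ).ne'
    ENNReal.ofReal_ne_top).1 hstep
  rw [measure_ball_half, mul_div_assoc]
  exact hmeas.trans (by gcongr)

theorem measure_lt_iterate_le (hw : IsDeGiorgiClass μ p Λ Ω w g) (hp : 1 ≤ p) (hΩ : IsOpen Ω)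
    {η : E → ℝ} {s ρ L k : ℝ} (hη : IsBarrier c s 1 L η) (hρ : 0 < ρ)
    (hs : Metric.closedBall c (s + ρ) ⊆ Ω)
    (hρL : 8 * ρ * (L + Λ L + 1) ≤ (1 / 2) ^ Module.finrank ℝ E) (hk0 : 0 < k) (hk1 : k ≤ 1)
    (hsmall : μ (Metric.ball c s ∩ {x | w x < k}) ≤ μ (Metric.ball 0 ρ) / 2) (j : ℕ) :
    μ {x | w x < k * η x - k / 2 * (1 - 1 / 2 ^ j)} ≤ μ (Metric.ball 0 (ρ / 2 ^ j)) / 2 := by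
  have hpow : ∀ j : ℕ, (1 : ℝ) ≤ 2 ^ j := fun j => one_le_pow₀ one_le_two
  have hψ : ∀ j : ℕ, IsBarrier c s k L fun x => k * η x - k / 2 * (1 - 1 / 2 ^ j) := fun j =>
    hη.const_mul_sub hk0.le (mul_nonneg (by positivity)
      (sub_nonneg.2 (div_le_one_of_le₀ (hpow j) (by positivity))))
  induction j with
  | zero =>
    refine (measure_mono fun x (hx : w x < _) => ?_).trans (by rwa [pow_zero, div_one])
    exact ⟨(hψ 0).sublevel_subset_ball hw.nonneg hx, hx.trans_le ((hψ 0).le x)⟩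
  | succ j ih =>
    have hnext : ∀ x, k * η x - k / 2 * (1 - 1 / 2 ^ (j + 1))
        = k * η x - k / 2 * (1 - 1 / 2 ^ j) - k / 4 * (1 / 2 ^ j) := fun x => by
      rw [pow_succ]
      field_simp
      ring
    have hρj : ρ / 2 ^ j ≤ ρ := div_le_self hρ.le (hpow j)
    simp only [hnext]
    rw [pow_succ, ← div_div]
    refine hw.measure_lt_sub_le_half hp hΩ (hψ j) (by positivity)
      ((Metric.closedBall_subset_closedBall (by gcongr)).trans hs) hk0 hk1 ih (by positivity) ?_
    calc 2 * (ρ / 2 ^ j) * k * (L + Λ L + 1)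
        = k / 4 * (1 / 2 ^ j) * (8 * ρ * (L + Λ L + 1)) := by ring
      _ ≤ _ := by gcongr

variable (μ) in
theorem exists_measure_ball_inter_lt_half_eq_zero [Nontrivial E] (hp : 1 ≤ p) (Λ : ℝ → ℝ≥0)
    (c : E) {s' s t : ℝ} (hs' : 0 < s') (hs : s' < s) (ht : s < t) :
    ∃ ν : ℝ, 0 < ν ∧ ∀ {Ω : Set E} {w : E → ℝ} {g : E → E}, IsDeGiorgiClass μ p Λ Ω w g →
      IsOpen Ω → Metric.closedBall c t ⊆ Ω → ∀ k : ℝ, 0 < k → k ≤ 1 →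
      μ (Metric.ball c s ∩ {x | w x < k}) ≤ ENNReal.ofReal ν →
      μ (Metric.ball c s' ∩ {x | w x < k / 2}) = 0 := by
  obtain ⟨η, L, hη, hη1⟩ := exists_isBarrier_eq_one c hs' hs
  have hL := hη.nonneg one_pos
  set K := L + Λ L + 1
  have : 0 < K := by positivity
  set ρ := min (t - s) ((1 / 2) ^ Module.finrank ℝ E / (8 * K))
  have hρ : 0 < ρ := lt_min (sub_pos.2 ht) (by positivity)
  have hρt : s + ρ ≤ t := le_sub_iff_add_le'.1 (min_le_left _ _)
  have hρK : 8 * ρ * K ≤ (1 / 2) ^ Module.finrank ℝ E := by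
    have := (le_div_iff₀ (by positivity)).1 (min_le_right (t - s) _ : ρ ≤ _ / (8 * K))
    linarith
  have hν := ENNReal.div_ne_top (measure_ball_lt_top (μ := μ) (x := 0) (r := ρ)).ne two_ne_zero
  refine ⟨(μ (Metric.ball 0 ρ) / 2).toReal, ENNReal.toReal_pos
    (ENNReal.half_pos (Metric.measure_ball_pos μ 0 hρ).ne').ne' hν, ?_⟩
  intro Ω w g hw hΩ htΩ k hk0 hk1 hk
  rw [ENNReal.ofReal_toReal hν] at hk
  have hle : ∀ j : ℕ, μ (Metric.ball c s' ∩ {x | w x < k / 2})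
      ≤ μ (Metric.ball 0 (ρ / 2 ^ j)) := fun j => by
    refine (measure_mono ?_).trans ((hw.measure_lt_iterate_le hp hΩ hη hρ
      ((Metric.closedBall_subset_closedBall hρt).trans htΩ) hρK hk0 hk1 hk j).trans
        ENNReal.half_le_self)
    rintro x ⟨hx, hxk : w x < k / 2⟩
    have : 0 < k / 2 * (1 / 2 ^ j) := by positivity
    rw [mem_ofPred_eq, hη1 x (Metric.ball_subset_closedBall hx)]
    linarith
  have hlim : Tendsto (fun j : ℕ => ρ / 2 ^ j) atTop (𝓝 0) :=
    tendsto_const_nhds.div_atTop (tendsto_pow_atTop_atTop_of_one_lt one_lt_two)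
  exact le_antisymm
    (ge_of_tendsto' (tendsto_measure_ball_zero μ 0 (fun j => by positivity) hlim) hle) zero_le

theorem measure_lt_half_mul_measure_le (hw : IsDeGiorgiClass μ p Λ Ω w g) (hΩ : IsOpen Ω)
    {η : E → ℝ} {r L k : ℝ} (hr : 0 < r) (hrΩ : Metric.closedBall c (4 * r) ⊆ Ω)
    (hη : IsBarrier c (4 * r) 1 L η) (hη1 : ∀ x ∈ Metric.closedBall c (3 * r), η x = 1)
    (hk0 : 0 < k) (hk1 : k ≤ 1) {ε C : ℝ} (hε : 0 ≤ ε) (hC : 0 ≤ C)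
    (hY : ∀ t : ℝ, 0 ≤ t → t ≤ ε * t ^ p + C) :
    ENNReal.ofReal (1 / 2) * μ (Metric.ball c r ∩ {x | w x < k / 2}) *
        μ (Metric.ball c r ∩ {x | k ≤ w x}) ≤
      μ (Metric.ball 0 (2 * r)) * (ENNReal.ofReal (2 * r) *
        (ENNReal.ofReal (ε * Λ L) * μ (Metric.ball c (4 * r)) + ENNReal.ofReal C *
          μ (Metric.closedBall c (3 * r) ∩ {x | k / 2 ≤ w x ∧ w x < k}))) := by
  have hψ : IsBarrier c (4 * r) k L fun x => k * η x := by
    simpa using hη.const_mul_sub hk0.le le_rfl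
  have hlevel : Metric.closedBall c (3 * r) ∩ {x | k / 2 ≤ w x ∧ w x < k} ⊆
      {x | w x < k * η x} := by
    rintro x ⟨hx, -, hxk⟩
    simpa [hη1 x hx] using hxk
  have hgrad := hw.lintegral_enorm_le hψ hrΩ hk0 hk1 hlevel hε hC hY
  have hiso := hw.hasWeakGrad.deGiorgi_isoperimetric hΩ hw.measurable (r := r)
    ((Metric.closedBall_subset_closedBall (by linarith)).trans hrΩ) (half_le_self hk0.le)
  refine (ENNReal.mul_le_mul_iff_right (ENNReal.ofReal_pos.2 hk0).ne'
    ENNReal.ofReal_ne_top).1 ?_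
  rw [← mul_assoc, ← mul_assoc, ← ENNReal.ofReal_mul hk0.le,
    (by ring : k * (1 / 2) = k - k / 2), mul_left_comm (ENNReal.ofReal k),
    mul_left_comm (ENNReal.ofReal k)]
  refine hiso.trans ?_
  gcongr
  refine hgrad.trans ?_
  gcongr
  exact hψ.sublevel_subset_ball hw.nonneg

theorem mul_le_measureReal_shell (hw : IsDeGiorgiClass μ p Λ Ω w g) (hΩ : IsOpen Ω)
    {η : E → ℝ} {r L k : ℝ} (hr : 0 < r) (hrΩ : Metric.closedBall c (4 * r) ⊆ Ω)
    (hη : IsBarrier c (4 * r) 1 L η) (hη1 : ∀ x ∈ Metric.closedBall c (3 * r), η x = 1)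
    (hk0 : 0 < k) (hk1 : k ≤ 1) {ε C : ℝ} (hε : 0 ≤ ε) (hC : 0 ≤ C)
    (hY : ∀ t : ℝ, 0 ≤ t → t ≤ ε * t ^ p + C) {α ν : ℝ} (hν : 0 ≤ ν)
    (hαw : ENNReal.ofReal α ≤ μ (Metric.ball c r ∩ {x | 1 ≤ w x}))
    (hνw : ENNReal.ofReal ν ≤ μ (Metric.ball c r ∩ {x | w x < k / 2})) :
    1 / 2 * ν * α ≤ μ.real (Metric.ball 0 (2 * r)) * (2 * r *
      (ε * Λ L * μ.real (Metric.ball c (4 * r)) +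
        C * μ.real (Metric.closedBall c (3 * r) ∩ {x | k / 2 ≤ w x ∧ w x < k}))) := by
  have hfin : μ (Metric.closedBall c (3 * r) ∩ {x | k / 2 ≤ w x ∧ w x < k}) ≠ ⊤ :=
    (measure_mono inter_subset_left |>.trans_lt measure_closedBall_lt_top).ne
  rw [← ENNReal.ofReal_le_ofReal_iff (by positivity), ENNReal.ofReal_mul (by positivity),
    ENNReal.ofReal_mul (by positivity), ENNReal.ofReal_mul measureReal_nonneg,
    ENNReal.ofReal_mul (p := 2 * r) (by positivity),
    ENNReal.ofReal_add (by positivity) (by positivity),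
    ENNReal.ofReal_mul (p := ε * Λ L) (by positivity), ENNReal.ofReal_mul hC,
    ofReal_measureReal hfin, ofReal_measureReal measure_ball_lt_top.ne,
    ofReal_measureReal measure_ball_lt_top.ne]
  refine le_trans ?_ (hw.measure_lt_half_mul_measure_le hΩ hr hrΩ hη hη1 hk0 hk1 hε hC hY)
  gcongr
  exact hαw.trans (measure_mono (inter_subset_inter_right _ fun x => hk1.trans))

variable (μ) in
theorem exists_measure_ball_inter_lt_le (hp : 1 < p) (Λ : ℝ → ℝ≥0) (c : E) {r α ν : ℝ}
    (hr : 0 < r) (hα : 0 < α) (hν : 0 < ν) :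
    ∃ k : ℝ, 0 < k ∧ k ≤ 1 ∧ ∀ {Ω : Set E} {w : E → ℝ} {g : E → E},
      IsDeGiorgiClass μ p Λ Ω w g → IsOpen Ω → Metric.closedBall c (4 * r) ⊆ Ω →
      ENNReal.ofReal α ≤ μ (Metric.ball c r ∩ {x | 1 ≤ w x}) →
      μ (Metric.ball c r ∩ {x | w x < k}) ≤ ENNReal.ofReal ν := by
  obtain ⟨η, L, hη, hη1⟩ :=
    exists_isBarrier_eq_one c (by positivity : 0 < 3 * r) (by linarith : 3 * r < 4 * r)
  set V := μ.real (Metric.ball c (4 * r))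
  set M := μ.real (Metric.ball (0 : E) (2 * r)) * (2 * r) with hM
  have hM0 : 0 < M := mul_pos (ENNReal.toReal_pos (Metric.measure_ball_pos μ 0 (by positivity)).ne'
    measure_ball_lt_top.ne) (by positivity)
  have hν' : 0 < 1 / 2 * ν * α := by positivity
  obtain ⟨ε, C, δ, hε, hC, hδ, hY, hlt⟩ :=
    exists_le_mul_rpow_add_of_mul_lt hp hM0 (by positivity : 0 ≤ Λ L * V) hν'
  obtain ⟨J, hJ⟩ := exists_nat_gt (V / δ)
  rw [div_lt_iff₀ hδ] at hJ
  refine ⟨(1 / 2) ^ J, by positivity, pow_le_one₀ (by norm_num) (by norm_num), ?_⟩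
  intro Ω w g hw hΩ hrΩ hαw
  by_contra! hbig
  have hanti : Antitone fun j : ℕ => (1 / 2 : ℝ) ^ j :=
    pow_right_anti₀ (by norm_num) (by norm_num)
  obtain ⟨j, hj, hshell⟩ := exists_measure_preimage_Ico_lt
    (μ := μ.restrict (Metric.closedBall c (3 * r))) hw.measurable hanti (J := J)
    (δ := ENNReal.ofReal δ) (by
      rw [Measure.restrict_apply_univ, ← ENNReal.ofReal_natCast J, ← ENNReal.ofReal_mul (by simp)]
      refine (measure_mono (Metric.closedBall_subset_ball
        (by linarith : 3 * r < 4 * r))).trans_lt ?_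
      rw [← ofReal_measureReal measure_ball_lt_top.ne]
      exact (ENNReal.ofReal_lt_ofReal_iff_of_nonneg measureReal_nonneg).2 hJ)
  have hhalf : (1 / 2 : ℝ) ^ (j + 1) = (1 / 2) ^ j / 2 := by rw [pow_succ, mul_one_div]
  have hbound := hw.mul_le_measureReal_shell hΩ hr hrΩ hη hη1 (k := (1 / 2) ^ j) (by positivity)
    (pow_le_one₀ (by norm_num) (by norm_num)) hε.le hC.le hY hν.le hαw
    (hbig.le.trans (measure_mono (inter_subset_inter_right _ fun x hx =>
      lt_of_lt_of_le hx ((hanti hj).trans_eq hhalf))))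
  rw [Measure.restrict_apply (hw.measurable measurableSet_Ico), inter_comm, hhalf] at hshell
  have hδle := ENNReal.toReal_le_of_le_ofReal hδ.le hshell.le
  refine hlt.not_ge (hbound.trans ?_)
  rw [hM, mul_assoc (μ.real _), mul_assoc ε]
  gcongr
  exact hδle

variable (μ) in
theorem exists_measure_ball_inter_lt_eq_zero [Nontrivial E] (hp : 1 < p) (Λ : ℝ → ℝ≥0) (c : E)
    {r α : ℝ} (hr : 0 < r) (hα : 0 < α) :
    ∃ κ : ℝ, 0 < κ ∧ ∀ {Ω : Set E} {w : E → ℝ} {g : E → E},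
      IsDeGiorgiClass μ p Λ Ω w g → IsOpen Ω → Metric.closedBall c (4 * r) ⊆ Ω →
      ENNReal.ofReal α ≤ μ (Metric.ball c r ∩ {x | 1 ≤ w x}) →
      μ (Metric.ball c (r / 2) ∩ {x | w x < κ}) = 0 := by
  obtain ⟨ν, hν, hsmall⟩ := exists_measure_ball_inter_lt_half_eq_zero μ hp.le Λ c
    (half_pos hr) (half_lt_self hr) (by linarith : r < 4 * r)
  obtain ⟨k, hk0, hk1, hlevel⟩ := exists_measure_ball_inter_lt_le μ hp Λ c hr hα hν
  exact ⟨k / 2, half_pos hk0, fun hw hΩ hrΩ hαw =>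
    hsmall hw hΩ hrΩ k hk0 hk1 (hlevel hw hΩ hrΩ hαw)⟩

end IsDeGiorgiClass

end Density

section Minimizers

open scoped ContDiff ENNReal NNReal

theorem locallyIntegrableOn_of_memLp {X β : Type*} [TopologicalSpace X] [R1Space X]
    [LocallyCompactSpace X] [MeasurableSpace X] [NormedAddCommGroup β] {μ : Measure X}
    [IsFiniteMeasureOnCompacts μ] {q : ℝ≥0∞} (hq : 1 ≤ q) {Ω : Set X} (hΩ : IsOpen Ω) {f : X → β}
    (hf : ∀ K, IsCompact K → K ⊆ Ω → MemLp f q (μ.restrict K)) : LocallyIntegrableOn f Ω μ :=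
  (locallyIntegrableOn_iff hΩ.isLocallyClosed).2 fun K hKΩ hK =>
    have : IsFiniteMeasure (μ.restrict K) := ⟨by simpa using hK.measure_lt_top⟩
    (hf K hK hKΩ).integrable hq

theorem setIntegral_mul_of_tsupport_subset {X : Type*} [TopologicalSpace X] [MeasurableSpace X]
    {μ : Measure X} {Ω : Set X} {χ : X → ℝ} (hχΩ : tsupport χ ⊆ Ω) (f : X → ℝ) :
    ∫ x in Ω, f x * χ x ∂μ = ∫ x, f x * χ x ∂μ :=
  setIntegral_eq_integral_of_forall_compl_eq_zero fun x hx => by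
    rw [image_eq_zero_of_notMem_tsupport fun h => hx (hχΩ h), mul_zero]

theorem setLIntegral_le_of_eqOn_sdiff {X : Type*} [MeasurableSpace X] {μ : Measure X} {A B : Set X}
    (hA : MeasurableSet A) (hB : MeasurableSet B) (hAB : A ⊆ B) {f f' : X → ℝ≥0∞}
    (heq : EqOn f f' (B \ A)) (hfin : ∫⁻ x in B, f x ∂μ ≠ ⊤)
    (hle : ∫⁻ x in B, f x ∂μ ≤ ∫⁻ x in B, f' x ∂μ) :
    ∫⁻ x in A, f x ∂μ ≤ ∫⁻ x in A, f' x ∂μ := by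
  rw [← lintegral_inter_add_sdiff f B hA, ← lintegral_inter_add_sdiff f' B hA,
    inter_eq_right.2 hAB, ← setLIntegral_congr_fun (hB.diff hA) heq] at hle
  exact (ENNReal.add_le_add_iff_right
    (ne_top_of_le_ne_top hfin (lintegral_mono_set sdiff_subset))).1 hle

theorem HasWeakGrad.of_span_eq_top {E : Type*} [NormedAddCommGroup E] [InnerProductSpace ℝ E]
    [MeasurableSpace E] [BorelSpace E] {μ : Measure E} {Ω : Set E} {f : E → ℝ} {G : E → E}
    {s : Set E} (hs : Submodule.span ℝ s = ⊤) (hf : LocallyIntegrableOn f Ω μ)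
    (h : ∀ e ∈ s, HasWeakDirDeriv μ Ω e f fun x => inner ℝ (G x) e) : HasWeakGrad μ Ω f G := by
  intro e
  refine Submodule.span_induction (p := fun e _ => HasWeakDirDeriv μ Ω e f fun x => inner ℝ (G x) e)
    h ?_ ?_ ?_ (hs ▸ Submodule.mem_top : e ∈ Submodule.span ℝ s)
  · exact ⟨hf, by simpa using locallyIntegrableOn_zero, by simp⟩
  · intro e e' _ _ he he'
    have hde := he.locallyIntegrableOn_deriv
    have hde' := he'.locallyIntegrableOn_deriv
    refine ⟨hf, by simp only [inner_add_right]; exact hde.add hde', fun φ hφ hφc hφΩ => ?_⟩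
    have hd := integrable_mul_of_tsupport_subset hde hφ.continuous hφc hφΩ
    have hd' := integrable_mul_of_tsupport_subset hde' hφ.continuous hφc hφΩ
    simp only [mul_comm _ (φ _)] at hd hd'
    simp only [map_add, inner_add_right, mul_add]
    rw [integral_add (integrable_mul_fderiv_of_tsupport_subset hf hφ hφc hφΩ e)
      (integrable_mul_fderiv_of_tsupport_subset hf hφ hφc hφΩ e'), integral_add hd hd',
      he.integral_eq φ hφ hφc hφΩ, he'.integral_eq φ hφ hφc hφΩ, neg_add]
  · intro a e _ he
    refine ⟨hf, by simp only [inner_smul_right]; exact he.locallyIntegrableOn_deriv.smul a,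
      fun φ hφ hφc hφΩ => ?_⟩
    simp only [map_smul, inner_smul_right, smul_eq_mul, mul_left_comm _ a, integral_const_mul,
      he.integral_eq φ hφ hφc hφΩ, mul_neg]

variable {n : ℕ} {p m lam : ℝ} {Ω : Set (EuclideanSpace ℝ (Fin n))}
  {F : EuclideanSpace ℝ (Fin n) → ℝ → EuclideanSpace ℝ (Fin n) → ℝ}
  {W : ℝ → EuclideanSpace ℝ (Fin n) → ℝ} {u v v' : EuclideanSpace ℝ (Fin n) → ℝ}
  {g g' : EuclideanSpace ℝ (Fin n) → EuclideanSpace ℝ (Fin n)}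

namespace HasWeakGradLoc

theorem locallyIntegrableOn (h : HasWeakGradLoc p Ω v g) (hp : 1 ≤ p) (hΩ : IsOpen Ω) :
    LocallyIntegrableOn v Ω volume :=
  locallyIntegrableOn_of_memLp (ENNReal.one_le_ofReal.2 hp) hΩ h.memLp

theorem locallyIntegrableOn_grad (h : HasWeakGradLoc p Ω v g) (hp : 1 ≤ p) (hΩ : IsOpen Ω) :
    LocallyIntegrableOn g Ω volume :=
  locallyIntegrableOn_of_memLp (ENNReal.one_le_ofReal.2 hp) hΩ h.memLp_grad

theorem hasWeakGrad (h : HasWeakGradLoc p Ω v g) (hp : 1 ≤ p) (hΩ : IsOpen Ω) :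
    HasWeakGrad volume Ω v g := by
  have hv := h.locallyIntegrableOn hp hΩ
  have hg := h.locallyIntegrableOn_grad hp hΩ
  refine HasWeakGrad.of_span_eq_top (EuclideanSpace.basisFun (Fin n) ℝ).toBasis.span_eq hv ?_
  rintro _ ⟨i, rfl⟩
  refine ⟨hv, ?_, fun φ hφ hφc hφΩ => ?_⟩
  · rw [locallyIntegrableOn_iff hΩ.isLocallyClosed] at hg ⊢
    exact fun K hKΩ hK => Integrable.inner_const (𝕜 := ℝ) (hg K hKΩ hK) _
  · simpa [EuclideanSpace.inner_single_right, mul_comm (φ _),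
      setIntegral_mul_of_tsupport_subset hφΩ, setIntegral_mul_of_tsupport_subset
        ((tsupport_fderiv_apply_subset ℝ (EuclideanSpace.single i 1)).trans hφΩ)]
      using h.integral_eq φ hφ hφc hφΩ i

theorem congr_ae (h : HasWeakGradLoc p Ω v g) (hv : v =ᵐ[volume.restrict Ω] v')
    (hg : g =ᵐ[volume.restrict Ω] g') : HasWeakGradLoc p Ω v' g' where
  memLp K hK hKΩ :=
    (memLp_congr_ae (ae_restrict_of_ae_restrict_of_subset hKΩ hv)).1 (h.memLp K hK hKΩ)
  memLp_grad K hK hKΩ :=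
    (memLp_congr_ae (ae_restrict_of_ae_restrict_of_subset hKΩ hg)).1 (h.memLp_grad K hK hKΩ)
  integral_eq φ hφ hφc hφΩ i := by
    have hv' : (fun x => v' x * fderiv ℝ φ x (EuclideanSpace.single i 1))
        =ᵐ[volume.restrict Ω] fun x => v x * fderiv ℝ φ x (EuclideanSpace.single i 1) :=
      hv.mono fun x hx => by simp only [hx]
    have hg' : (fun x => φ x * g x i) =ᵐ[volume.restrict Ω] fun x => φ x * g' x i :=
      hg.mono fun x hx => by simp only [hx]
    rw [integral_congr_ae hv', h.integral_eq φ hφ hφc hφΩ i, integral_congr_ae hg']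

end HasWeakGradLoc

theorem HasWeakGrad.hasWeakGradLoc (h : HasWeakGrad volume Ω v g)
    (hv : ∀ K, IsCompact K → K ⊆ Ω → MemLp v (ENNReal.ofReal p) (volume.restrict K))
    (hg : ∀ K, IsCompact K → K ⊆ Ω → MemLp g (ENNReal.ofReal p) (volume.restrict K)) :
    HasWeakGradLoc p Ω v g := by
  refine ⟨hv, hg, fun φ hφ hφc hφΩ i => ?_⟩
  simpa [EuclideanSpace.inner_single_right, mul_comm (φ _),
    setIntegral_mul_of_tsupport_subset hφΩ, setIntegral_mul_of_tsupport_subset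
      ((tsupport_fderiv_apply_subset ℝ (EuclideanSpace.single i 1)).trans hφΩ)]
    using (h (EuclideanSpace.single i 1)).integral_eq φ hφ hφc hφΩ

theorem HasWeakGrad.hasWeakGradLoc_of_le (h : HasWeakGrad volume Ω v g) (hvm : Measurable v)
    (hgm : Measurable g) {a b : ℝ} (hv : ∀ x, |v x| ≤ a) (hg : ∀ x, ‖g x‖ ≤ ‖g' x‖ + b)
    (hg' : ∀ K, IsCompact K → K ⊆ Ω → MemLp g' (ENNReal.ofReal p) (volume.restrict K)) :
    HasWeakGradLoc p Ω v g := by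
  refine h.hasWeakGradLoc (fun K hK _ => ?_) fun K hK hKΩ => ?_ <;>
    have : IsFiniteMeasure (volume.restrict K) := ⟨by simpa using hK.measure_lt_top⟩
  · exact MemLp.of_bound hvm.aestronglyMeasurable a (Eventually.of_forall hv)
  · exact ((hg' K hK hKΩ).norm.add (memLp_const b)).mono hgm.aestronglyMeasurable
      (Eventually.of_forall fun x => (hg x).trans (le_abs_self _))

section Energy

theorem PotentialGrowth.nonneg (hW : PotentialGrowth m lam W) (hlam : 0 ≤ lam) {τ : ℝ}
    (hτ : τ ∈ Icc (-1 : ℝ) 1) (x : EuclideanSpace ℝ (Fin n)) : 0 ≤ W τ x :=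
  (mul_nonneg (inv_nonneg.2 hlam)
    (Real.rpow_nonneg (by nlinarith [hτ.1, hτ.2]) _)).trans (hW τ x hτ).1

theorem PotentialGrowth.le_of_sub_le (hW : PotentialGrowth m lam W) (hlam : 0 ≤ lam) (hm : 0 ≤ m)
    {τ k : ℝ} (hτ : τ ∈ Icc (-1 : ℝ) 1) (hk : 1 - k ≤ τ) (x : EuclideanSpace ℝ (Fin n)) :
    W τ x ≤ lam * (2 * k) ^ m := by
  refine (hW τ x hτ).2.trans (mul_le_mul_of_nonneg_left (Real.rpow_le_rpow ?_ ?_ hm) hlam) <;>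
    nlinarith [hτ.1, hτ.2]

theorem ofReal_inv_mul_lintegral_le_glEnergy (hF : DirichletGrowth p lam F)
    (hW : PotentialGrowth m lam W) (hlam : 0 ≤ lam) (hv : ∀ x, v x ∈ Icc (-1 : ℝ) 1)
    (g : EuclideanSpace ℝ (Fin n) → EuclideanSpace ℝ (Fin n)) (D : Set (EuclideanSpace ℝ (Fin n))) :
    ENNReal.ofReal lam⁻¹ * ∫⁻ x in D, ENNReal.ofReal (‖g x‖ ^ p) ≤ glEnergy F W v g D := by
  rw [glEnergy, ← lintegral_const_mul' _ _ ENNReal.ofReal_ne_top]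
  refine lintegral_mono fun x => ?_
  rw [← ENNReal.ofReal_mul (inv_nonneg.2 hlam)]
  exact ENNReal.ofReal_le_ofReal
    (le_add_of_le_of_nonneg (hF _ _ x (hv x)).1 (hW.nonneg hlam (hv x) x))

theorem glEnergy_le_of_norm_le (hF : DirichletGrowth p lam F) (hW : PotentialGrowth m lam W)
    (hlam : 0 ≤ lam) (hp : 0 ≤ p) (hpm : p ≤ m) {k L : ℝ} (hk : 0 < k) (hk1 : k ≤ 1) (hL : 0 ≤ L)
    {D : Set (EuclideanSpace ℝ (Fin n))} (hD : MeasurableSet D)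
    (hv : ∀ x ∈ D, v x ∈ Icc (1 - k) 1) (hg : ∀ x ∈ D, ‖g x‖ ≤ k * L) :
    glEnergy F W v g D ≤ ENNReal.ofReal (lam * ((L ^ p + 2 ^ m) * k ^ p)) * volume D := by
  rw [glEnergy, ← setLIntegral_const]
  refine setLIntegral_mono' hD fun x hx => ENNReal.ofReal_le_ofReal ?_
  have hvx : v x ∈ Icc (-1 : ℝ) 1 := ⟨by linarith [(hv x hx).1], (hv x hx).2⟩
  calc F (g x) (v x) x + W (v x) x
      ≤ lam * (k * L) ^ p + lam * (2 * k) ^ m := by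
        refine add_le_add ((hF _ _ x hvx).2.trans ?_)
          (hW.le_of_sub_le hlam (hp.trans hpm) hvx (hv x hx).1 x)
        gcongr
        exact hg x hx
    _ = lam * (L ^ p * k ^ p + 2 ^ m * k ^ m) := by
        rw [Real.mul_rpow hk.le hL, Real.mul_rpow two_pos.le hk.le]
        ring
    _ ≤ lam * (L ^ p * k ^ p + 2 ^ m * k ^ p) := by
        have := Real.rpow_le_rpow_of_exponent_ge hk hk1 hpm
        gcongr
    _ = lam * ((L ^ p + 2 ^ m) * k ^ p) := by ring

theorem HasWeakGradLoc.glEnergy_ne_top (h : HasWeakGradLoc p Ω v g) (hp : 0 < p)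
    (hF : DirichletGrowth p lam F) (hW : PotentialGrowth m lam W) (hlam : 0 ≤ lam) (hm : 0 ≤ m)
    (hv : ∀ x, v x ∈ Icc (-1 : ℝ) 1) {K : Set (EuclideanSpace ℝ (Fin n))} (hK : IsCompact K)
    (hKΩ : K ⊆ Ω) : glEnergy F W v g K ≠ ⊤ := by
  have : IsFiniteMeasure (volume.restrict K) := ⟨by simpa using hK.measure_lt_top⟩
  have hgp : Integrable (fun x => ‖g x‖ ^ p) (volume.restrict K) := by
    simpa only [ENNReal.toReal_ofReal hp.le] using (h.memLp_grad K hK hKΩ).integrable_norm_rpow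
      (ENNReal.ofReal_pos.2 hp).ne' ENNReal.ofReal_ne_top
  refine ne_top_of_le_ne_top
    ((hgp.const_mul lam).add (integrable_const (lam * (2 * 2) ^ m))).lintegral_lt_top.ne
    (lintegral_mono fun x => ENNReal.ofReal_le_ofReal (add_le_add (hF _ _ x (hv x)).2
      (hW.le_of_sub_le hlam hm (hv x) ?_ x)))
  linarith [(hv x).1]

end Energy

/-- A representative of a minimizer that is measurable with values in `[-1, 1]` everywhere, with a
measurable representative `g` of its weak gradient. The competitors are likewise restricted to
those for which the bounds and the boundary condition hold everywhere. -/
structure IsMeasurableGLMinimizer (p : ℝ)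
    (F : EuclideanSpace ℝ (Fin n) → ℝ → EuclideanSpace ℝ (Fin n) → ℝ)
    (W : ℝ → EuclideanSpace ℝ (Fin n) → ℝ) (Ω : Set (EuclideanSpace ℝ (Fin n)))
    (u : EuclideanSpace ℝ (Fin n) → ℝ)
    (g : EuclideanSpace ℝ (Fin n) → EuclideanSpace ℝ (Fin n)) : Prop where
  measurable : Measurable u
  measurable_grad : Measurable g
  mem_Icc : ∀ x, u x ∈ Icc (-1 : ℝ) 1
  hasWeakGradLoc : HasWeakGradLoc p Ω u g
  energy_le : ∀ Ω' : Set (EuclideanSpace ℝ (Fin n)), IsOpen Ω' → IsCompact (closure Ω') →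
    closure Ω' ⊆ Ω → ∀ (v : EuclideanSpace ℝ (Fin n) → ℝ)
      (gv : EuclideanSpace ℝ (Fin n) → EuclideanSpace ℝ (Fin n)),
      HasWeakGradLoc p Ω v gv → (∀ x, v x ∈ Icc (-1 : ℝ) 1) → (∀ x ∉ Ω', v x = u x) →
      glEnergy F W u g Ω' ≤ glEnergy F W v gv Ω'

theorem IsGLMinimizer.exists_measurable (hu : IsGLMinimizer p F W Ω u) (hp : 1 ≤ p)
    (hΩ : IsOpen Ω) :
    ∃ u₀ g₀, IsMeasurableGLMinimizer p F W Ω u₀ g₀ ∧ u =ᵐ[volume.restrict Ω] u₀ := by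
  obtain ⟨hIcc, g, hg, hmin⟩ := hu
  have hum := (hg.locallyIntegrableOn hp hΩ).aestronglyMeasurable.aemeasurable
  have hgm := (hg.locallyIntegrableOn_grad hp hΩ).aestronglyMeasurable.aemeasurable
  set u₀ : EuclideanSpace ℝ (Fin n) → ℝ := fun x => max (-1) (min 1 (hum.mk u x)) with hu₀
  have huu₀ : u =ᵐ[volume.restrict Ω] u₀ := by
    filter_upwards [hum.ae_eq_mk, hIcc] with x hx hx'
    simp only [hu₀]
    rw [← hx, min_eq_right hx'.2, max_eq_right hx'.1]
  have hgg₀ := hgm.ae_eq_mk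
  refine ⟨u₀, hgm.mk g, ⟨?_, hgm.measurable_mk, fun x => ⟨le_max_left _ _, ?_⟩,
    hg.congr_ae huu₀ hgg₀, fun Ω' hΩ' hc hΩ'Ω v gv hv hvI hvu => ?_⟩, huu₀⟩
  · exact measurable_const.max (measurable_const.min hum.measurable_mk)
  · exact max_le (by norm_num) (min_le_left _ _)
  · have hsub : Ω' ⊆ Ω := subset_closure.trans hΩ'Ω
    have henergy : glEnergy F W u₀ (hgm.mk g) Ω' = glEnergy F W u g Ω' := by
      refine lintegral_congr_ae ?_
      filter_upwards [ae_restrict_of_ae_restrict_of_subset hsub huu₀,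
        ae_restrict_of_ae_restrict_of_subset hsub hgg₀] with x hx hx'
      rw [hx, hx']
    rw [henergy]
    refine hmin Ω' hΩ' hc hΩ'Ω v gv hv (Eventually.of_forall hvI) ?_
    filter_upwards [ae_restrict_of_ae_restrict_of_subset (sdiff_subset (t := Ω')) huu₀,
      ae_restrict_mem (hΩ.measurableSet.diff hΩ'.measurableSet)] with x hx hxm
    rw [hx, hvu x hxm.2]

namespace IsMeasurableGLMinimizer

variable {c : EuclideanSpace ℝ (Fin n)} {s k L : ℝ} {ψ : EuclideanSpace ℝ (Fin n) → ℝ}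

open Classical in
/-- The competitor is `min u (1 - ψ)`. -/
theorem exists_competitor (hu : IsMeasurableGLMinimizer p F W Ω u g) (hp : 1 ≤ p) (hΩ : IsOpen Ω)
    (hψ : IsBarrier c s k L ψ) (hk : 0 < k) (hk1 : k ≤ 1) :
    ∃ v gv, HasWeakGradLoc p Ω v gv ∧ (∀ x, v x ∈ Icc (-1 : ℝ) 1) ∧
      (∀ x, 1 - u x < ψ x → v x ∈ Icc (1 - k) 1 ∧ ‖gv x‖ ≤ k * L) ∧
      ∀ x, ψ x ≤ 1 - u x → v x = u x ∧ gv x = g x := by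
  have hψ1 : ContDiff ℝ 1 ψ := hψ.contDiff.of_le (by simp)
  have hgψ (x : EuclideanSpace ℝ (Fin n)) : ‖-gradient ψ x‖ ≤ k * L :=
    (norm_neg _).trans_le (hψ.norm_gradient_le x)
  have hgψm : Measurable (gradient ψ) := ((InnerProductSpace.toDual ℝ _).symm.continuous.comp
    (hψ1.continuous_fderiv one_ne_zero)).measurable
  have hAm : MeasurableSet {x | 1 - ψ x < u x} :=
    measurableSet_lt (measurable_const.sub hψ1.continuous.measurable) hu.measurable
  have hgrad := (hu.hasWeakGradLoc.hasWeakGrad hp hΩ).inf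
    ((HasWeakGrad.of_contDiff Ω hψ1).const_sub 1) hΩ
  have hvI (x : EuclideanSpace ℝ (Fin n)) : min (u x) (1 - ψ x) ∈ Icc (-1 : ℝ) 1 :=
    ⟨le_min (hu.mem_Icc x).1 (by linarith [hψ.le x]), min_le_of_left_le (hu.mem_Icc x).2⟩
  refine ⟨_, _, hgrad.hasWeakGradLoc_of_le (hu.measurable.min
      (measurable_const.sub hψ1.continuous.measurable))
      (hgψm.neg.piecewise hAm hu.measurable_grad) (fun x => abs_le.2 (hvI x)) (b := k * L)
      (fun x => ?_) hu.hasWeakGradLoc.memLp_grad, hvI, fun x hx => ⟨?_, ?_⟩, fun x hx => ⟨?_, ?_⟩⟩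
  · by_cases hx : 1 - ψ x < u x
    · simpa [hx] using (hgψ x).trans (le_add_of_nonneg_left (norm_nonneg (g x)))
    · simpa [hx] using mul_nonneg hk.le (hψ.nonneg hk)
  · exact ⟨le_min (by linarith [hψ.le x]) (by linarith [hψ.le x]), (hvI x).2⟩
  · rw [piecewise_eq_of_mem {x | 1 - ψ x < u x} _ _ (show 1 - ψ x < u x by linarith)]
    exact hgψ x
  · exact min_eq_left (by linarith)
  · exact piecewise_eq_of_notMem _ _ _ (show ¬ 1 - ψ x < u x by linarith)

theorem glEnergy_le_of_isBarrier (hu : IsMeasurableGLMinimizer p F W Ω u g) (hp : 1 ≤ p)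
    (hpm : p ≤ m) (hlam : 0 ≤ lam) (hF : DirichletGrowth p lam F) (hW : PotentialGrowth m lam W)
    (hΩ : IsOpen Ω) (hψ : IsBarrier c s k L ψ) (hsΩ : Metric.closedBall c s ⊆ Ω) (hk : 0 < k)
    (hk1 : k ≤ 1) :
    glEnergy F W u g {x | 1 - u x < ψ x}
      ≤ ENNReal.ofReal (lam * ((L ^ p + 2 ^ m) * k ^ p)) * volume {x | 1 - u x < ψ x} := by
  have hAm : MeasurableSet {x | 1 - u x < ψ x} :=
    measurableSet_lt (measurable_const.sub hu.measurable) hψ.contDiff.continuous.measurable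
  have hAs : {x | 1 - u x < ψ x} ⊆ Metric.ball c s :=
    hψ.sublevel_subset_ball fun x => sub_nonneg.2 (hu.mem_Icc x).2
  have hcl : closure (Metric.ball c s) ⊆ Metric.closedBall c s :=
    Metric.closure_ball_subset_closedBall
  have hcpt := isCompact_closedBall c s
  have hp0 : 0 < p := one_pos.trans_le hp
  obtain ⟨v, gv, hvloc, hvI, hvA, hvAc⟩ := hu.exists_competitor hp hΩ hψ hk hk1
  have hfin : glEnergy F W u g (Metric.ball c s) ≠ ⊤ := ne_top_of_le_ne_top
    (hu.hasWeakGradLoc.glEnergy_ne_top hp0 hF hW hlam (hp0.le.trans hpm) hu.mem_Icc hcpt hsΩ)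
    (lintegral_mono_set Metric.ball_subset_closedBall)
  have hmin := hu.energy_le _ Metric.isOpen_ball (hcpt.of_isClosed_subset isClosed_closure hcl)
    (hcl.trans hsΩ) v gv hvloc hvI fun x hx => (hvAc x (not_lt.1 fun h => hx (hAs h))).1
  have hlocal := setLIntegral_le_of_eqOn_sdiff hAm measurableSet_ball hAs
    (fun x hx => by obtain ⟨hv, hgv⟩ := hvAc x (not_lt.1 hx.2); simp only [hv, hgv]) hfin hmin
  exact hlocal.trans (glEnergy_le_of_norm_le hF hW hlam hp0.le hpm hk hk1 (hψ.nonneg hk) hAm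
    (fun x hx => (hvA x hx).1) fun x hx => (hvA x hx).2)

theorem isDeGiorgiClass (hu : IsMeasurableGLMinimizer p F W Ω u g) (hp : 1 ≤ p) (hpm : p ≤ m)
    (hlam : 0 < lam) (hF : DirichletGrowth p lam F) (hW : PotentialGrowth m lam W)
    (hΩ : IsOpen Ω) :
    IsDeGiorgiClass volume p (fun L => Real.toNNReal (lam ^ 2 * (L ^ p + 2 ^ m))) Ω
      (fun x => 1 - u x) (fun x => -g x) where
  measurable := measurable_const.sub hu.measurable
  measurable_grad := hu.measurable_grad.neg
  nonneg x := sub_nonneg.2 (hu.mem_Icc x).2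
  hasWeakGrad := (hu.hasWeakGradLoc.hasWeakGrad hp hΩ).const_sub 1
  lintegral_rpow_le {c s k L ψ} hψ hsΩ hk hk1 := by
    have hL := hψ.nonneg hk
    have hlow := ofReal_inv_mul_lintegral_le_glEnergy hF hW hlam.le hu.mem_Icc g
      {x | 1 - u x < ψ x}
    have hup := hu.glEnergy_le_of_isBarrier hp hpm hlam.le hF hW hΩ hψ hsΩ hk hk1
    rw [Real.coe_toNNReal _ (by positivity)]
    simp only [norm_neg]
    calc ∫⁻ x in {x | 1 - u x < ψ x}, ENNReal.ofReal (‖g x‖ ^ p)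
        = ENNReal.ofReal lam * (ENNReal.ofReal lam⁻¹
            * ∫⁻ x in {x | 1 - u x < ψ x}, ENNReal.ofReal (‖g x‖ ^ p)) := by
          rw [← mul_assoc, ← ENNReal.ofReal_mul hlam.le, mul_inv_cancel₀ hlam.ne',
            ENNReal.ofReal_one, one_mul]
      _ ≤ ENNReal.ofReal lam * (ENNReal.ofReal (lam * ((L ^ p + 2 ^ m) * k ^ p))
            * volume {x | 1 - u x < ψ x}) := by
          gcongr ENNReal.ofReal lam * ?_
          exact hlow.trans hup
      _ = _ := by
          rw [← mul_assoc, ← ENNReal.ofReal_mul hlam.le]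
          ring_nf

end IsMeasurableGLMinimizer

end Minimizers

section Conclusion

theorem nhds_inf_ae_neBot {X : Type*} [TopologicalSpace X] [MeasurableSpace X] (μ : Measure X)
    [μ.IsOpenPosMeasure] (x : X) : (𝓝 x ⊓ ae μ).NeBot :=
  inf_neBot_iff_frequently_right.2 fun hp =>
    mem_closure_iff_frequently.1 (Measure.dense_of_ae hp x)

theorem volume_ball_div_eight {n : ℕ} {R : ℝ} (hR : 0 < R) (c : EuclideanSpace ℝ (Fin n)) :
    volume (Metric.ball c (R / 8))
      = 2 * ENNReal.ofReal
        (volume.real (Metric.ball (0 : EuclideanSpace ℝ (Fin n)) 1) / (2 * 8 ^ n) * R ^ n) := by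
  rw [Measure.addHaar_ball_of_pos _ _ (by positivity), finrank_euclideanSpace_fin,
    two_mul, ← ENNReal.ofReal_add (by positivity) (by positivity),
    ← ofReal_measureReal measure_ball_lt_top.ne, ← ENNReal.ofReal_mul (by positivity), div_pow]
  ring_nf

theorem le_measure_inter_le_zero {X : Type*} [MeasurableSpace X] {μ : Measure X} {B : Set X}
    {f : X → ℝ} {a : ENNReal} (ha : a ≠ ⊤) (hB : μ B = 2 * a) (h : μ (B ∩ {x | 0 ≤ f x}) ≤ a) :
    a ≤ μ (B ∩ {x | f x ≤ 0}) := by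
  have hcover : B ⊆ B ∩ {x | 0 ≤ f x} ∪ B ∩ {x | f x ≤ 0} := fun x hx =>
    (le_total 0 (f x)).imp (⟨hx, ·⟩) (⟨hx, ·⟩)
  rw [← ENNReal.add_le_add_iff_left ha, ← two_mul, ← hB]
  exact (measure_mono hcover).trans ((measure_union_le _ _).trans (add_le_add h le_rfl))

variable {n : ℕ} {p m lam : ℝ}

theorem essValue_le_of_ae_ball {u : EuclideanSpace ℝ (Fin n) → ℝ} {c : EuclideanSpace ℝ (Fin n)}
    {s a b : ℝ} (hs : 0 < s) (h : ∀ᵐ x ∂volume.restrict (Metric.ball c s), u x ∈ Icc a b) :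
    essValue u c ≤ b := by
  have := nhds_inf_ae_neBot volume c
  rw [ae_restrict_iff' measurableSet_ball] at h
  have hev : ∀ᶠ x in 𝓝 c ⊓ ae volume, u x ∈ Icc a b := by
    filter_upwards [mem_inf_of_left (Metric.ball_mem_nhds c hs),
      h.filter_mono inf_le_right] with x hx hux using hux hx
  have hbdd : IsBoundedUnder (· ≥ ·) (𝓝 c ⊓ ae volume) u := ⟨a, hev.mono fun _ hx => hx.1⟩
  exact limsup_le_of_le hbdd.isCoboundedUnder_le (hev.mono fun _ hx => hx.2)

theorem exists_essValue_le_one_sub (hn : 1 ≤ n) (hp : 1 < p) (hpm : p ≤ m) (hlam : 0 < lam)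
    (c : EuclideanSpace ℝ (Fin n)) {r α : ℝ} (hr : 0 < r) (hα : 0 < α) :
    ∃ κ : ℝ, 0 < κ ∧ ∀ {F W Ω u}, IsGLMinimizer p F W Ω u → DirichletGrowth p lam F →
      PotentialGrowth m lam W → IsOpen Ω → Metric.closedBall c (4 * r) ⊆ Ω →
      ENNReal.ofReal α ≤ volume (Metric.ball c r ∩ {x | u x ≤ 0}) → essValue u c ≤ 1 - κ := by
  have : Nonempty (Fin n) := ⟨⟨0, hn⟩⟩
  obtain ⟨κ, hκ, hzero⟩ := IsDeGiorgiClass.exists_measure_ball_inter_lt_eq_zero volume hp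
    (fun L => Real.toNNReal (lam ^ 2 * (L ^ p + 2 ^ m))) c hr hα
  refine ⟨κ, hκ, fun {F W Ω u} hu hF hW hΩ hcΩ hαu => ?_⟩
  obtain ⟨u₀, g₀, hu₀, huu₀⟩ := hu.exists_measurable hp.le hΩ
  have hball {s : ℝ} (hs : s ≤ 4 * r) : u =ᵐ[volume.restrict (Metric.ball c s)] u₀ :=
    ae_restrict_of_ae_restrict_of_subset
      ((Metric.ball_subset_closedBall.trans (Metric.closedBall_subset_closedBall hs)).trans hcΩ)
      huu₀
  have hαu₀ : ENNReal.ofReal α ≤ volume (Metric.ball c r ∩ {x | 1 ≤ 1 - u₀ x}) := by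
    refine hαu.trans (measure_mono_ae ?_)
    filter_upwards [(ae_restrict_iff' measurableSet_ball).1 (hball (by linarith : r ≤ 4 * r))]
      with x hx hxu
    refine ⟨hxu.1, ?_⟩
    have hux : u x ≤ 0 := hxu.2
    rw [mem_ofPred_eq, ← hx hxu.1]
    linarith
  have hnull := hzero (hu₀.isDeGiorgiClass hp.le hpm hlam hF hW hΩ) hΩ hcΩ hαu₀
  refine essValue_le_of_ae_ball (half_pos hr) (a := -1) ?_
  filter_upwards [hball (by linarith : r / 2 ≤ 4 * r), ae_restrict_mem measurableSet_ball,
    ae_restrict_of_ae (measure_eq_zero_iff_ae_notMem.1 hnull)] with x hx hxb hxκ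
  rw [hx]
  have hκu : κ ≤ 1 - u₀ x := not_lt.1 fun hlt => hxκ ⟨hxb, hlt⟩
  exact ⟨(hu₀.mem_Icc x).1, by linarith⟩

theorem lemma2p3_general (n : ℕ) (hn : 1 ≤ n) (p m lam : ℝ) (hp : 1 < p) (hpm : p ≤ m)
    (hlam : 0 < lam) :
    ∃ σ : ℝ, 0 < σ ∧ ∃ h : ℝ → ℝ, (∀ R : ℝ, 0 < R → 0 < h R) ∧
      ∀ (F : EuclideanSpace ℝ (Fin n) → ℝ → EuclideanSpace ℝ (Fin n) → ℝ)
        (W : ℝ → EuclideanSpace ℝ (Fin n) → ℝ),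
        DirichletGrowth p lam F → PotentialGrowth m lam W →
        ∀ R : ℝ, 0 < R →
        ∀ Ω : Set (EuclideanSpace ℝ (Fin n)), IsOpen Ω → Metric.ball 0 R ⊆ Ω →
        ∀ u : EuclideanSpace ℝ (Fin n) → ℝ, IsGLMinimizer p F W Ω u →
          1 - h R ≤ essValue u 0 →
          ENNReal.ofReal (σ * R ^ n) ≤ volume (Metric.ball 0 R ∩ {x | 0 ≤ u x}) := by
  set σ := volume.real (Metric.ball (0 : EuclideanSpace ℝ (Fin n)) 1) / (2 * 8 ^ n)
  have hσ0 : 0 < σ := div_pos (ENNReal.toReal_pos (Metric.measure_ball_pos volume 0 one_pos).ne'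
    measure_ball_lt_top.ne) (by positivity)
  choose! κ hκ hdrop using fun (R : ℝ) (hR : 0 < R) => exists_essValue_le_one_sub hn hp hpm hlam 0
    (by positivity : 0 < R / 8) (by positivity : 0 < σ * R ^ n)
  refine ⟨σ, hσ0, fun R => κ R / 2, fun R hR => half_pos (hκ R hR), ?_⟩
  intro F W hF hW R hR Ω hΩ hRΩ u hu hval
  by_contra! hsmall
  have hhalf : ENNReal.ofReal (σ * R ^ n) ≤ volume (Metric.ball 0 (R / 8) ∩ {x | u x ≤ 0}) :=
    le_measure_inter_le_zero ENNReal.ofReal_ne_top (volume_ball_div_eight hR 0) <|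
      (measure_mono (inter_subset_inter_left _ (Metric.ball_subset_ball (by linarith)))).trans
        hsmall.le
  have hκR := hκ R hR
  linarith [hdrop R hR hu hF hW hΩ
    ((Metric.closedBall_subset_ball (by linarith)).trans hRΩ) hhalf]

end Conclusion

theorem lemma2p3 (n : ℕ) (hn : 1 ≤ n) (p m lam : ℝ) (hp : 1 < p)
    (hpn : p * ((n : ℝ) - 1) < (n : ℝ)) (hm : p < m) (hlam : 0 < lam) :
    ∃ σ : ℝ, 0 < σ ∧ ∃ h : ℝ → ℝ, (∀ R : ℝ, 1 ≤ R → 0 < h R) ∧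
      ∀ (F : EuclideanSpace ℝ (Fin n) → ℝ → EuclideanSpace ℝ (Fin n) → ℝ)
        (W : ℝ → EuclideanSpace ℝ (Fin n) → ℝ),
        DirichletGrowth p lam F → PotentialGrowth m lam W → PotentialMonotone W →
        ∀ R : ℝ, 1 ≤ R →
        ∀ Ω : Set (EuclideanSpace ℝ (Fin n)), IsOpen Ω → Metric.ball 0 R ⊆ Ω →
        ∀ u : EuclideanSpace ℝ (Fin n) → ℝ, IsGLMinimizer p F W Ω u →
          1 - h R ≤ essValue u 0 →
          ENNReal.ofReal (σ * R ^ n) ≤ volume (Metric.ball 0 R ∩ {x | 0 ≤ u x}) := by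
  obtain ⟨σ, hσ, h, hh, hdensity⟩ := lemma2p3_general n hn p m lam hp hm.le hlam
  exact ⟨σ, hσ, h, fun R hR => hh R (one_pos.trans_le hR), fun F W hF hW _ R hR =>
    hdensity F W hF hW R (one_pos.trans_le hR)⟩
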